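/- **Language and frames.** Let $\mathrm{ML}$ be the basic modal language over countably many variables, with primitives $\bot,\top,\neg,\lor,\land,\Diamond,\Box$; $\mathrm{ML}^+$ adds nominals (true at exactly one world each; one of them, $\mathbf i$, is reserved for the current state) and the inverse modalities $\Diamond^{-1},\Box^{-1}$. A formula is pure if it contains no propositional variable. A general frame $\mathfrak F=(W,R,\mathbb W)$ is a Kripke frame $(W,R)$ with a Boolean algebra $\mathbb W$ of subsets of $W$ closed under $X\mapsto\{w:\exists v\,(Rwv\wedge v\in X)\}$; $\mathfrak F,w\Vdash\varphi$ means that $\varphi$ is true at $w$ under all valuations with values in $\mathbb W$. $\mathfrak F$ is descriptive if it is differentiated (distinct points are separated by members of $\mathbb W$), tight ($Rxy$ iff every $Y\in\mathbb W$ with $y\in Y$ contains a successor of $x$) and compact (every subfamily of $\mathbb W$ with the finite intersection property has non-empty intersection). **The algorithm SQEMA** on input $\varphi\in\mathrm{ML}$: bring $\neg\varphi$ into negation normal form and distribute $\Diamond$ and $\land$ over $\lor$ until it has the form $\bigvee_k\alpha_k$ where no further disjunction can be extracted from any $\alpha_k$ (distribution inside boxes is optional). For each $k$, start from the system consisting of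 the single equation $\mathbf i\to\alpha_k$ and transform it by finitely many applications of the following rules, in any order ($\alpha\to\beta$ stands for $\neg\alpha\lor\beta$, a bare formula $\gamma$ for $\top\to\gamma$, and systems are unordered). * Replace $\beta\to\gamma\land\delta$ by $\beta\to\gamma$ and $\beta\to\delta$; interchange $\beta\to\gamma\lor\delta$ and $(\beta\land\neg\gamma)\to\delta$; interchange $\gamma\to\Box\delta$ and $\Diamond^{-1}\gamma\to\delta$; replace $\mathbf j\to\Diamond\gamma$ by $\mathbf j\to\Diamond\mathbf k$ and $\mathbf k\to\gamma$, with $\mathbf j$ a nominal and $\mathbf k\neq\mathbf i$ a nominal not occurring in the system. * Ackermann-rule: if $p$ does not occur in $\alpha_1,\dots,\alpha_n$ and every other equation of the system is negative in $p$, delete $\alpha_1\to p,\dots,\alpha_n\to p$ and substitute $\alpha_1\lor\dots\lor\alpha_n$ for $p$ in the others. * Substitute $\neg p$ for $p$ everywhere; if the system is positive (negative) in $p$, substitute $\top$ ($\bot$) for $p$. * Inside formulae use commutativity and associativity of $\land,\lor$, the equivalences for moving negations inwards (including the duality of the modalities), and the replacements $\gamma\lor\neg\gamma\mapsto\top$,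 $\gamma\land\neg\gamma\mapsto\bot$, $\gamma\lor\top\mapsto\top$, $\gamma\lor\bot\mapsto\gamma$, $\gamma\land\top\mapsto\gamma$, $\gamma\land\bot\mapsto\bot$; replace the equations $\gamma\to\bot$, $\gamma\to\top$, $\bot\to\gamma$, $\top\to\gamma$ by $\neg\gamma$, $\top$, $\top$, $\gamma$ respectively; delete $\top$. SQEMA succeeds on $\varphi$ if, for every $k$, some such execution ends in a system without propositional variables. If $\mathsf{pure}_k$ is the conjunction of the equations of the final system for $\alpha_k$ (equations read as formulae), SQEMA returns the first-order formula $$\bigwedge_k\forall\bar y\,\exists x_0\,\neg\mathrm{ST}(\mathsf{pure}_k,x_0)$$ in the language with equality and one binary predicate $R$. Here $\mathrm{ST}$ is the standard translation, with $\mathrm{ST}(\mathbf j,x)$ being $x=y_{\mathbf j}$; $\bar y$ are the variables $y_{\mathbf j}$ of the nominals $\mathbf j\ne\mathbf i$ that occur in $\mathsf{pure}_k$, and $y_{\mathbf i}$ is left free. **Theorem.** Suppose SQEMA succeeds on $\varphi\in\mathrm{ML}$. Then: 1. $\varphi$ is locally d-persistent: for every descriptive frame $\mathfrak F=(W,R,\mathbb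 W)$ and $w\in W$, $\mathfrak F,w\Vdash\varphi$ iff $(W,R),w\Vdash\varphi$. 2. $\varphi$ is canonical: for every normal modal logic $\Lambda$ with $\varphi\in\Lambda$, $\varphi$ is valid on the canonical Kripke frame of $\Lambda$ (whose worlds are the maximal $\Lambda$-consistent sets). 3. Every first-order formula $\chi(y_{\mathbf i})$ that a successful execution of SQEMA on $\varphi$ returns is a local first-order frame correspondent of $\varphi$: for every Kripke frame $(W,R)$ and $w\in W$, $(W,R),w\Vdash\varphi$ iff $(W,R)\models\chi[y_{\mathbf i}:=w]$. -/

import Mathlib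

universe u

namespace Sqema



/-! ### The basic modal language, Kripke semantics -/

/-- Formulae of the basic modal language; `var k` is the propositional variable `p_k`. -/
inductive ML : Type
  | bot : ML
  | top : ML
  | var : ℕ → ML
  | neg : ML → ML
  | or : ML → ML → ML
  | and : ML → ML → ML
  | dia : ML → ML
  | box : ML → ML

namespace ML

def imp (φ ψ : ML) : ML := or (neg φ) ψ

def iff (φ ψ : ML) : ML := and (imp φ ψ) (imp ψ φ)

/-- Truth of a formula at a world of the Kripke model with accessibility relation `R` and
valuation `V`. -/
def Sat {W : Type u} (R : W → W → Prop) (V : ℕ → Set W) : ML → W → Prop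
  | bot, _ => False
  | top, _ => True
  | var k, w => w ∈ V k
  | neg φ, w => ¬ Sat R V φ w
  | or φ ψ, w => Sat R V φ w ∨ Sat R V ψ w
  | and φ ψ, w => Sat R V φ w ∧ Sat R V ψ w
  | dia φ, w => ∃ v, R w v ∧ Sat R V φ v
  | box φ, w => ∀ v, R w v → Sat R V φ v

/-- Uniform substitution. -/
def subst (σ : ℕ → ML) : ML → ML
  | bot => bot
  | top => top
  | var k => σ k
  | neg φ => neg (subst σ φ)
  | or φ ψ => or (subst σ φ) (subst σ ψ)
  | and φ ψ => and (subst σ φ) (subst σ ψ)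
  | dia φ => dia (subst σ φ)
  | box φ => box (subst σ φ)

/-- Finite conjunction. -/
def conj : List ML → ML
  | [] => top
  | [φ] => φ
  | φ :: ψ :: l => and φ (conj (ψ :: l))

end ML

/-- Validity of `φ` at the world `w` of the Kripke frame `(W, R)`. -/
def ValidAt {W : Type u} (R : W → W → Prop) (w : W) (φ : ML) : Prop :=
  ∀ V : ℕ → Set W, φ.Sat R V w

/-! ### General and descriptive frames, local d-persistence -/

/-- General frames on the set of worlds `W`. Non-emptiness of `W` is not recorded, as frames
are only considered together with a world. -/
structure GeneralFrame (W : Type u) where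
  R : W → W → Prop
  /-- the admissible sets -/
  Adm : Set (Set W)
  empty_mem : ∅ ∈ Adm
  compl_mem : ∀ X ∈ Adm, Xᶜ ∈ Adm
  union_mem : ∀ X ∈ Adm, ∀ Y ∈ Adm, X ∪ Y ∈ Adm
  dia_mem : ∀ X ∈ Adm, {w | ∃ v, R w v ∧ v ∈ X} ∈ Adm

namespace GeneralFrame

variable {W : Type u} (F : GeneralFrame W)

def Differentiated : Prop :=
  ∀ x y : W, x ≠ y → ∃ X ∈ F.Adm, x ∈ X ∧ y ∉ X

def Tight : Prop :=
  ∀ x y : W, F.R x y ↔ ∀ Y ∈ F.Adm, y ∈ Y → ∃ v, F.R x v ∧ v ∈ Y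

/-- Every family of admissible sets with the finite intersection property has non-empty
intersection. -/
def Compact : Prop :=
  ∀ C : Set (Set W), C ⊆ F.Adm →
    (∀ D : Set (Set W), D ⊆ C → D.Finite → (⋂₀ D).Nonempty) → (⋂₀ C).Nonempty

def Descriptive : Prop := F.Differentiated ∧ F.Tight ∧ F.Compact

/-- Local validity at a world of a general frame: truth under all admissible valuations. -/
def ValidAt (w : W) (φ : ML) : Prop :=
  ∀ V : ℕ → Set W, (∀ k, V k ∈ F.Adm) → φ.Sat F.R V w

end GeneralFrame

def LocallyDPersistent (φ : ML) : Prop :=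
  ∀ (W : Type u) (F : GeneralFrame W), F.Descriptive →
    ∀ w : W, F.ValidAt w φ ↔ ValidAt F.R w φ

/-! ### Canonicity -/

/-- Propositional tautologies: formulae true under every assignment of truth values that respects
the Boolean connectives (formulae `◇φ`, `□φ` being treated as atoms). -/
def Tautology (φ : ML) : Prop :=
  ∀ v : ML → Prop, ¬ v .bot → v .top → (∀ a, v (.neg a) ↔ ¬ v a) →
    (∀ a b, v (.or a b) ↔ (v a ∨ v b)) → (∀ a b, v (.and a b) ↔ (v a ∧ v b)) → v φ

/-- Normal modal logics. -/
structure IsNormalLogic (L : Set ML) : Prop where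
  taut : ∀ φ, Tautology φ → φ ∈ L
  axK : ∀ φ ψ, ML.imp (.box (ML.imp φ ψ)) (ML.imp (.box φ) (.box ψ)) ∈ L
  dual : ∀ φ, ML.iff (.dia φ) (.neg (.box (.neg φ))) ∈ L
  mp : ∀ φ ψ, ML.imp φ ψ ∈ L → φ ∈ L → ψ ∈ L
  nec : ∀ φ, φ ∈ L → .box φ ∈ L
  subst : ∀ (σ : ℕ → ML) (φ), φ ∈ L → φ.subst σ ∈ L

/-- `Γ` is `L`-consistent: no finite conjunction of members of `Γ` is refuted by `L`. -/
def Consistent (L Γ : Set ML) : Prop :=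
  ∀ l : List ML, (∀ ψ ∈ l, ψ ∈ Γ) → .neg (ML.conj l) ∉ L

/-- Worlds of the canonical frame of `L`: the maximal `L`-consistent sets. -/
def CanonicalWorld (L : Set ML) : Type :=
  {Γ : Set ML // Consistent L Γ ∧ ∀ Δ : Set ML, Γ ⊆ Δ → Consistent L Δ → Δ = Γ}

/-- The accessibility relation of the canonical frame of `L`. -/
def canonicalRel (L : Set ML) (Γ Δ : CanonicalWorld L) : Prop :=
  ∀ ψ, ψ ∈ Δ.1 → .dia ψ ∈ Γ.1

/-- `φ` is canonical: it is valid on the canonical frame of every normal modal logic that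
contains it. -/
def Canonical (φ : ML) : Prop :=
  ∀ L : Set ML, IsNormalLogic L → φ ∈ L →
    ∀ Γ : CanonicalWorld L, ValidAt (canonicalRel L) Γ φ

/-! ### The extended language with nominals and inverse modalities -/

/-- Formulae of the extended language; `nom 0` is the reserved nominal for the current state. -/
inductive HF : Type
  | bot : HF
  | top : HF
  | var : ℕ → HF
  | nom : ℕ → HF
  | neg : HF → HF
  | or : HF → HF → HF
  | and : HF → HF → HF
  | dia : HF → HF
  | box : HF → HF
  | idia : HF → HF
  | ibox : HF → HF

namespace HF

def ofML : ML → HF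
  | .bot => bot
  | .top => top
  | .var k => var k
  | .neg φ => neg (ofML φ)
  | .or φ ψ => or (ofML φ) (ofML ψ)
  | .and φ ψ => and (ofML φ) (ofML ψ)
  | .dia φ => dia (ofML φ)
  | .box φ => box (ofML φ)

/-- The nominals occurring in a formula. -/
def noms : HF → Finset ℕ
  | bot => ∅
  | top => ∅
  | var _ => ∅
  | nom j => {j}
  | neg φ => noms φ
  | or φ ψ => noms φ ∪ noms ψ
  | and φ ψ => noms φ ∪ noms ψ
  | dia φ => noms φ
  | box φ => noms φ
  | idia φ => noms φ
  | ibox φ => noms φ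

/-- The propositional variables occurring in a formula. -/
def vars : HF → Finset ℕ
  | bot => ∅
  | top => ∅
  | var k => {k}
  | nom _ => ∅
  | neg φ => vars φ
  | or φ ψ => vars φ ∪ vars ψ
  | and φ ψ => vars φ ∪ vars ψ
  | dia φ => vars φ
  | box φ => vars φ
  | idia φ => vars φ
  | ibox φ => vars φ

/-- Pure formulae: no propositional variable occurs. -/
def Pure : HF → Prop
  | bot => True
  | top => True
  | var _ => False
  | nom _ => True
  | neg φ => Pure φ
  | or φ ψ => Pure φ ∧ Pure ψ
  | and φ ψ => Pure φ ∧ Pure ψ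
  | dia φ => Pure φ
  | box φ => Pure φ
  | idia φ => Pure φ
  | ibox φ => Pure φ

/-- `PolarIn p true φ`: every occurrence of the variable `p` in `φ` is positive, i.e. in the scope
of an even number of negations; `PolarIn p false φ`: every occurrence of `p` in `φ` is negative. -/
def PolarIn (p : ℕ) : Bool → HF → Prop
  | _, bot => True
  | _, top => True
  | s, var k => k = p → s = true
  | _, nom _ => True
  | s, neg φ => PolarIn p (!s) φ
  | s, or φ ψ => PolarIn p s φ ∧ PolarIn p s ψ
  | s, and φ ψ => PolarIn p s φ ∧ PolarIn p s ψ
  | s, dia φ => PolarIn p s φ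
  | s, box φ => PolarIn p s φ
  | s, idia φ => PolarIn p s φ
  | s, ibox φ => PolarIn p s φ

/-- `subst p A φ` is `φ(A/p)`. -/
def subst (p : ℕ) (A : HF) : HF → HF
  | bot => bot
  | top => top
  | var k => if k = p then A else var k
  | nom j => nom j
  | neg φ => neg (subst p A φ)
  | or φ ψ => or (subst p A φ) (subst p A ψ)
  | and φ ψ => and (subst p A φ) (subst p A ψ)
  | dia φ => dia (subst p A φ)
  | box φ => box (subst p A φ)
  | idia φ => idia (subst p A φ)
  | ibox φ => ibox (subst p A φ)

/-- Finite disjunction. -/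
def disj : List HF → HF
  | [] => bot
  | [φ] => φ
  | φ :: ψ :: l => or φ (disj (ψ :: l))

/-- Finite conjunction. -/
def conj : List HF → HF
  | [] => top
  | [φ] => φ
  | φ :: ψ :: l => and φ (conj (ψ :: l))

end HF

/-! ### The rules of the algorithm -/

/-- The equivalences used tacitly: commutativity and associativity of `∧` and `∨`, and those for
moving negations inwards (negation normal form, duality of the modal operators). -/
inductive Tacit : HF → HF → Prop
  | or_comm (a b) : Tacit (.or a b) (.or b a)
  | and_comm (a b) : Tacit (.and a b) (.and b a)
  | or_assoc (a b c) : Tacit (.or (.or a b) c) (.or a (.or b c))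
  | and_assoc (a b c) : Tacit (.and (.and a b) c) (.and a (.and b c))
  | neg_neg (a) : Tacit (.neg (.neg a)) a
  | neg_bot : Tacit (.neg .bot) .top
  | neg_top : Tacit (.neg .top) .bot
  | neg_or (a b) : Tacit (.neg (.or a b)) (.and (.neg a) (.neg b))
  | neg_and (a b) : Tacit (.neg (.and a b)) (.or (.neg a) (.neg b))
  | neg_dia (a) : Tacit (.neg (.dia a)) (.box (.neg a))
  | neg_box (a) : Tacit (.neg (.box a)) (.dia (.neg a))
  | neg_idia (a) : Tacit (.neg (.idia a)) (.ibox (.neg a))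
  | neg_ibox (a) : Tacit (.neg (.ibox a)) (.idia (.neg a))
  | neg_dia_neg (a) : Tacit (.neg (.dia (.neg a))) (.box a)
  | neg_box_neg (a) : Tacit (.neg (.box (.neg a))) (.dia a)
  | neg_idia_neg (a) : Tacit (.neg (.idia (.neg a))) (.ibox a)
  | neg_ibox_neg (a) : Tacit (.neg (.ibox (.neg a))) (.idia a)

/-- One application of an auxiliary rule to a subformula. -/
inductive Rewrite : HF → HF → Prop
  | tacit {a b} : Tacit a b → Rewrite a b
  | tacit_symm {a b} : Tacit a b → Rewrite b a
  | or_neg (a) : Rewrite (.or a (.neg a)) .top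
  | and_neg (a) : Rewrite (.and a (.neg a)) .bot
  | or_top (a) : Rewrite (.or a .top) .top
  | or_bot (a) : Rewrite (.or a .bot) a
  | and_top (a) : Rewrite (.and a .top) a
  | and_bot (a) : Rewrite (.and a .bot) .bot
  | neg {a b} : Rewrite a b → Rewrite (.neg a) (.neg b)
  | or_left {a b} (c) : Rewrite a b → Rewrite (.or a c) (.or b c)
  | or_right {a b} (c) : Rewrite a b → Rewrite (.or c a) (.or c b)
  | and_left {a b} (c) : Rewrite a b → Rewrite (.and a c) (.and b c)
  | and_right {a b} (c) : Rewrite a b → Rewrite (.and c a) (.and c b)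
  | dia {a b} : Rewrite a b → Rewrite (.dia a) (.dia b)
  | box {a b} : Rewrite a b → Rewrite (.box a) (.box b)
  | idia {a b} : Rewrite a b → Rewrite (.idia a) (.idia b)
  | ibox {a b} : Rewrite a b → Rewrite (.ibox a) (.ibox b)

/-- Equations `α → β`. Some rules turn an equation into a bare formula `γ`, which is then
kept in the system. All of them are understood as holding in the whole model. -/
inductive Equation : Type
  | imp : HF → HF → Equation
  | fml : HF → Equation

namespace Equation

/-- The formula expressed by an equation. -/
def toHF : Equation → HF
  | imp α β => .or (.neg α) β
  | fml γ => γ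

def subst (p : ℕ) (A : HF) : Equation → Equation
  | imp α β => imp (HF.subst p A α) (HF.subst p A β)
  | fml γ => fml (HF.subst p A γ)

end Equation

/-- Systems of equations, read conjunctively. -/
abbrev System : Type := List Equation

/-- The conjunction of all equations of a system. -/
def System.toHF (E : System) : HF := HF.conj (E.map Equation.toHF)

/-- Rules that replace one equation by finitely many equations. -/
inductive EqRule : Equation → List Equation → Prop
  /- the ∧-rule -/
  | and_rule (β γ δ) : EqRule (.imp β (.and γ δ)) [.imp β γ, .imp β δ]
  /- the left-shift and right-shift ∨-rules -/
  | or_left_shift (β γ δ) : EqRule (.imp β (.or γ δ)) [.imp (.and β (.neg γ)) δ]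
  | or_right_shift (β γ δ) : EqRule (.imp (.and β (.neg γ)) δ) [.imp β (.or γ δ)]
  /- the left-shift and right-shift □-rules -/
  | box_left_shift (γ δ) : EqRule (.imp γ (.box δ)) [.imp (.idia γ) δ]
  | box_right_shift (γ δ) : EqRule (.imp (.idia γ) δ) [.imp γ (.box δ)]
  /- auxiliary rules inside an equation -/
  | rewrite_left {α α'} (β) : Rewrite α α' → EqRule (.imp α β) [.imp α' β]
  | rewrite_right (α) {β β'} : Rewrite β β' → EqRule (.imp α β) [.imp α β']
  | rewrite_fml {γ γ'} : Rewrite γ γ' → EqRule (.fml γ) [.fml γ']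
  /- auxiliary rules for equations with `⊤` or `⊥` on one side -/
  | imp_bot (γ) : EqRule (.imp γ .bot) [.fml (.neg γ)]
  | imp_top (γ) : EqRule (.imp γ .top) [.fml .top]
  | bot_imp (γ) : EqRule (.imp .bot γ) [.fml .top]
  | top_imp (γ) : EqRule (.imp .top γ) [.fml γ]
  /- a bare formula `γ` may be read as the equation `⊤ → γ`, an implication `¬α ∨ β` being
  written `α → β` -/
  | fml_top_imp (γ) : EqRule (.fml γ) [.imp .top γ]
  | imp_fml (α β) : EqRule (.imp α β) [.fml (.or (.neg α) β)]
  /- the tautology `⊤` may be removed -/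
  | drop_top : EqRule (.fml .top) []

/-- One step of the execution on a system of equations. -/
inductive Step : System → System → Prop
  /- the order of the equations in a system is immaterial -/
  | perm {E E' : System} : E.Perm E' → Step E E'
  | eq_rule (e : Equation) (es E : System) : EqRule e es → Step (e :: E) (es ++ E)
  /- the ◇-rule, `k` a new nominal, distinct from the reserved one -/
  | dia_rule (j k : ℕ) (γ : HF) (E : System) : k ≠ 0 →
      (∀ e ∈ Equation.imp (.nom j) (.dia γ) :: E, k ∉ e.toHF.noms) →
      Step (.imp (.nom j) (.dia γ) :: E)
        (.imp (.nom j) (.dia (.nom k)) :: .imp (.nom k) γ :: E)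
  /- the Ackermann-rule; equations in which `p` does not occur are among the members of `B` -/
  | ackermann (p : ℕ) (A : List HF) (B : System) :
      (∀ α ∈ A, p ∉ α.vars) → (∀ e ∈ B, e.toHF.PolarIn p false) →
      Step (A.map (fun α => .imp α (.var p)) ++ B) (B.map (Equation.subst p (HF.disj A)))
  /- the polarity switching rule -/
  | switch (p : ℕ) (E : System) : Step E (E.map (Equation.subst p (.neg (.var p))))
  /- elimination of a variable in which the system is positive, respectively negative -/
  | elim_pos (p : ℕ) (E : System) :
      (∀ e ∈ E, e.toHF.PolarIn p true) → Step E (E.map (Equation.subst p .top))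
  | elim_neg (p : ℕ) (E : System) :
      (∀ e ∈ E, e.toHF.PolarIn p false) → Step E (E.map (Equation.subst p .bot))

/-! ### Preprocessing -/

namespace ML

/-- `nnf true φ` is a negation normal form of `φ`, and `nnf false φ` one of `¬φ`. -/
def nnf : Bool → ML → ML
  | true, bot => bot
  | false, bot => top
  | true, top => top
  | false, top => bot
  | true, var k => var k
  | false, var k => neg (var k)
  | s, neg φ => nnf (!s) φ
  | true, or φ ψ => or (nnf true φ) (nnf true ψ)
  | false, or φ ψ => and (nnf false φ) (nnf false ψ)
  | true, and φ ψ => and (nnf true φ) (nnf true ψ)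
  | false, and φ ψ => or (nnf false φ) (nnf false ψ)
  | true, dia φ => dia (nnf true φ)
  | false, dia φ => box (nnf false φ)
  | true, box φ => box (nnf true φ)
  | false, box φ => dia (nnf false φ)

/-- One distribution of a diamond or a conjunction over a disjunction, in a formula in negation
normal form. -/
inductive Distribute : ML → ML → Prop
  | dia_or (a b) : Distribute (dia (or a b)) (or (dia a) (dia b))
  | or_and (a b c) : Distribute (and (or a b) c) (or (and a c) (and b c))
  | and_or (a b c) : Distribute (and a (or b c)) (or (and a b) (and a c))
  | or_left {a b} (c) : Distribute a b → Distribute (or a c) (or b c)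
  | or_right {a b} (c) : Distribute a b → Distribute (or c a) (or c b)
  | and_left {a b} (c) : Distribute a b → Distribute (and a c) (and b c)
  | and_right {a b} (c) : Distribute a b → Distribute (and c a) (and c b)
  | dia {a b} : Distribute a b → Distribute (dia a) (dia b)
  | box {a b} : Distribute a b → Distribute (box a) (box b)

/-- The disjuncts `α_k` of a formula `⋁ α_k`. -/
def disjuncts : ML → List ML
  | or φ ψ => disjuncts φ ++ disjuncts ψ
  | φ => [φ]

/-- For formulae in negation normal form: no disjunction occurs outside the scope of boxes. -/
def NoOuterOr : ML → Prop
  | or _ _ => False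
  | and φ ψ => NoOuterOr φ ∧ NoOuterOr ψ
  | dia φ => NoOuterOr φ
  | _ => True

end ML

/-- `as` lists the formulae `α_k` obtained from the input `φ`: the negation normal form of `¬φ`
is brought into the form `⋁ α_k` by distributing diamonds and conjunctions over disjunctions until
no disjunction can be extracted from any `α_k` any more. Distribution in the scope of boxes is
optional. -/
def Preprocess (φ : ML) (as : List ML) : Prop :=
  ∃ ψ : ML, Relation.ReflTransGen ML.Distribute (ML.nnf false φ) ψ ∧
    (∀ α ∈ ψ.disjuncts, α.NoOuterOr) ∧ as = ψ.disjuncts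

/-! ### The first-order output -/

/-- The symbols of the first-order frame language: one binary predicate. -/
inductive FrameRel : ℕ → Type
  | acc : FrameRel 2

/-- The first-order language with equality and one binary predicate. -/
def L0 : FirstOrder.Language.{0, 0} := ⟨fun _ => Empty, FrameRel⟩

def accSym : L0.Relations 2 := FrameRel.acc

/-- A Kripke frame as a first-order structure. -/
@[reducible] def frameStructure {W : Type u} (R : W → W → Prop) : L0.Structure W where
  funMap f _ := f.elim
  RelMap
    | .acc, xs => R (xs 0) (xs 1)

/-- The atomic formula `R x y`. -/
def accF {n : ℕ} (x y : ℕ ⊕ Fin n) : L0.BoundedFormula ℕ n :=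
  FirstOrder.Language.Relations.boundedFormula₂ accSym (.var x) (.var y)

/-- A variable, seen below one more quantifier. -/
def lift {n : ℕ} (x : ℕ ⊕ Fin n) : ℕ ⊕ Fin (n + 1) := x.map id Fin.castSucc

/-- The variable bound by the innermost quantifier. -/
def newest (n : ℕ) : ℕ ⊕ Fin (n + 1) := .inr (Fin.last n)

/-- The standard translation `ST(φ, x)` of a pure formula. The free variable `j : ℕ` is the
reserved variable `y_j` of the nominal `nom j`; the bound variables are `Fin n`. -/
def ST : (φ : HF) → φ.Pure → {n : ℕ} → (x : ℕ ⊕ Fin n) → L0.BoundedFormula ℕ n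
  | .bot, _, _, _ => ⊥
  | .top, _, _, _ => ⊤
  | .var _, h, _, _ => h.elim
  | .nom j, _, _, x => .equal (.var x) (.var (.inl j))
  | .neg φ, h, _, x => (ST φ h x).not
  | .or φ ψ, h, _, x => ST φ h.1 x ⊔ ST ψ h.2 x
  | .and φ ψ, h, _, x => ST φ h.1 x ⊓ ST ψ h.2 x
  | .dia φ, h, n, x => (accF (lift x) (newest n) ⊓ ST φ h (newest n)).ex
  | .box φ, h, n, x => ((accF (lift x) (newest n)).imp (ST φ h (newest n))).all
  | .idia φ, h, n, x => (accF (newest n) (lift x) ⊓ ST φ h (newest n)).ex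
  | .ibox φ, h, n, x => ((accF (newest n) (lift x)).imp (ST φ h (newest n))).all

/-- `∃ x₀ ¬ ST(φ, x₀)`, with the variables `y_j` free. -/
def existsNotST (φ : HF) (h : φ.Pure) : L0.Formula ℕ := (ST φ h (newest 0)).not.ex

open Classical in
/-- `∀ ȳ ∃ x₀ ¬ ST(φ, x₀)`, where `ȳ` are the variables of the nominals occurring in `φ` other than
the reserved one, whose variable (the single element of `Unit`) is left free. -/
noncomputable def output (φ : HF) (h : φ.Pure) : L0.Formula Unit :=
  FirstOrder.Language.Formula.iAlls (β := {j // j ∈ φ.noms.erase 0})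
    ((existsNotST φ h).relabel fun j : ℕ =>
      if hj : j ∈ φ.noms.erase 0 then (Sum.inr ⟨j, hj⟩ : Unit ⊕ {j // j ∈ φ.noms.erase 0})
      else Sum.inl ())

/-- Finite conjunction of first-order formulae. -/
def conjFO : List (L0.Formula Unit) → L0.Formula Unit
  | [] => ⊤
  | [χ] => χ
  | χ :: χ' :: l => χ ⊓ conjFO (χ' :: l)

/-! ### Success of the algorithm -/

/-- On the disjunct `α`, starting from the single equation `𝐢 → α`, some execution eliminates all
propositional variables, and `χ` is the translation of the resulting pure system. -/
def BranchReturns (α : ML) (χ : L0.Formula Unit) : Prop :=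
  ∃ E : System, Relation.ReflTransGen Step [.imp (.nom 0) (HF.ofML α)] E ∧
    ∃ h : E.toHF.Pure, χ = output E.toHF h

/-- Some execution of SQEMA on the input `φ` succeeds and returns `χ`. -/
def Returns (φ : ML) (χ : L0.Formula Unit) : Prop :=
  ∃ (as : List ML) (χs : List (L0.Formula Unit)), Preprocess φ as ∧
    List.Forall₂ BranchReturns as χs ∧ χ = conjFO χs

/-- SQEMA succeeds on `φ`. -/
def Succeeds (φ : ML) : Prop := ∃ χ, Returns φ χ

/-- `χ` is a local first-order frame correspondent of `φ`. -/
def LocalCorrespondent (χ : L0.Formula Unit) (φ : ML) : Prop :=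
  ∀ (W : Type u) (R : W → W → Prop) (w : W),
    ValidAt R w φ ↔
      @FirstOrder.Language.Formula.Realize L0 W (frameStructure R) Unit χ (fun _ => w)

end Sqema

/-!
SQEMA transforms the system `𝐢 → α`, where `α` is a disjunct of `¬φ`, into a pure system. Call a
system satisfiable at `w` (`Satisfiable`) if it holds in the whole of some model on the frame whose
valuation is admissible and whose reserved nominal names `w`. Every rule preserves satisfiability
(`Step.satisfiable_iff`); only the Ackermann-rule makes a demand on the admissible sets, isolated as
`HasAckermann`. Since the satisfiability of a pure system does not depend on the admissible
sets, the first-order output expresses local validity of `φ` on every frame with that property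
(`Returns.realize_iff`). On a Kripke frame, where all sets are admissible, the property is trivial,
and the output is a local correspondent.

On a descriptive frame the property rests on the invariant `HF.PureOrOpen`: every equation is pure
or syntactically open, i.e. nominals and `◇⁻¹` occur only negatively and `□⁻¹` only positively. The
admissible sets are a basis of a compact topology in which points are closed, `◇` and `◇⁻¹` preserve
closed sets, and `□` and `□⁻¹` preserve open sets. Hence the left sides `α` of equations `α → p` have
closed values, and syntactically open formulae have open ones. If such a formula, negative in `p`,
holds everywhere when `p` takes a closed value `A`, then by Esakia's lemma (`exists_adm_sat`) and
compactness it still holds everywhere when `p` takes some admissible value containing `A`.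
This gives `Descriptive.hasAckermann`. As the same first-order formula then describes validity on the
descriptive frame and on its Kripke frame, `φ` is locally d-persistent.

Canonicity follows, because the canonical general frame is descriptive and, by the truth lemma
`sat_canonical_iff`, validates every formula of the logic.
-/

namespace Sqema

/-! ### Semantics of the extended language -/

namespace HF

/-- Truth of a formula of the extended language at a world, the nominal `nom j` naming the world
`g j`. -/
def Sat {W : Type u} (R : W → W → Prop) (g : ℕ → W) (V : ℕ → Set W) : HF → W → Prop
  | bot, _ => False
  | top, _ => True
  | var k, w => w ∈ V k
  | nom j, w => w = g j
  | neg φ, w => ¬ Sat R g V φ w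
  | or φ ψ, w => Sat R g V φ w ∨ Sat R g V ψ w
  | and φ ψ, w => Sat R g V φ w ∧ Sat R g V ψ w
  | dia φ, w => ∃ v, R w v ∧ Sat R g V φ v
  | box φ, w => ∀ v, R w v → Sat R g V φ v
  | idia φ, w => ∃ v, R v w ∧ Sat R g V φ v
  | ibox φ, w => ∀ v, R v w → Sat R g V φ v

/-- `SynClosed true φ`: `φ` is syntactically closed, i.e. nominals and `◇⁻¹` occur only positively
and `□⁻¹` only negatively. `SynClosed false φ`: `φ` is syntactically open, the dual condition. -/
def SynClosed : Bool → HF → Prop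
  | _, bot => True
  | _, top => True
  | _, var _ => True
  | s, nom _ => s = true
  | s, neg φ => SynClosed (!s) φ
  | s, or φ ψ => SynClosed s φ ∧ SynClosed s ψ
  | s, and φ ψ => SynClosed s φ ∧ SynClosed s ψ
  | s, dia φ => SynClosed s φ
  | s, box φ => SynClosed s φ
  | s, idia φ => s = true ∧ SynClosed s φ
  | s, ibox φ => s = false ∧ SynClosed s φ

variable {W : Type u} {R : W → W → Prop}

theorem sat_ofML (g : ℕ → W) (V : ℕ → Set W) (φ : ML) (x : W) :
    (ofML φ).Sat R g V x ↔ φ.Sat R V x := by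
  induction φ generalizing x <;> simp_all [ofML, Sat, ML.Sat]

theorem sat_congr_noms {g g' : ℕ → W} (V : ℕ → Set W) {φ : HF} (h : ∀ j ∈ φ.noms, g j = g' j)
    (x : W) : φ.Sat R g V x ↔ φ.Sat R g' V x := by
  induction φ generalizing x with
  | bot | top | var => rfl
  | nom j => simp [Sat, h j (by simp [noms])]
  | neg φ ih | dia φ ih | box φ ih | idia φ ih | ibox φ ih => simp only [Sat, ih h]
  | or φ ψ ih ih' | and φ ψ ih ih' =>
    simp only [noms, Finset.mem_union] at h
    simp only [Sat, ih fun j hj => h j (.inl hj), ih' fun j hj => h j (.inr hj)]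

theorem sat_congr_vars (g : ℕ → W) {V V' : ℕ → Set W} {φ : HF} (h : ∀ k ∈ φ.vars, V k = V' k)
    (x : W) : φ.Sat R g V x ↔ φ.Sat R g V' x := by
  induction φ generalizing x with
  | bot | top | nom => rfl
  | var k => simp [Sat, h k (by simp [vars])]
  | neg φ ih | dia φ ih | box φ ih | idia φ ih | ibox φ ih => simp only [Sat, ih h]
  | or φ ψ ih ih' | and φ ψ ih ih' =>
    simp only [vars, Finset.mem_union] at h
    simp only [Sat, ih fun j hj => h j (.inl hj), ih' fun j hj => h j (.inr hj)]

theorem Pure.sat_congr {φ : HF} (hφ : φ.Pure) (g : ℕ → W) (V V' : ℕ → Set W) (x : W) :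
    φ.Sat R g V x ↔ φ.Sat R g V' x := by
  induction φ generalizing x with
  | bot | top | nom => rfl
  | var k => exact hφ.elim
  | neg φ ih | dia φ ih | box φ ih | idia φ ih | ibox φ ih => simp only [Sat, ih hφ]
  | or φ ψ ih ih' | and φ ψ ih ih' => simp only [Sat, ih hφ.1, ih' hφ.2]

theorem sat_subst (g : ℕ → W) (V : ℕ → Set W) (p : ℕ) (A φ : HF) (x : W) :
    (subst p A φ).Sat R g V x ↔ φ.Sat R g (Function.update V p {y | A.Sat R g V y}) x := by
  induction φ generalizing x with
  | bot | top | nom => rfl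
  | var k =>
    by_cases h : k = p
    · subst h; simp [subst, Sat]
    · simp [subst, Sat, h]
  | neg φ ih | dia φ ih | box φ ih | idia φ ih | ibox φ ih => simp only [subst, Sat, ih]
  | or φ ψ ih ih' | and φ ψ ih ih' => simp only [subst, Sat, ih, ih']

/-- Monotonicity in positive variables, antitonicity in negative ones. -/
theorem sat_mono_polar (g : ℕ → W) (V : ℕ → Set W) (p : ℕ) {C D : Set W} (h : C ⊆ D) (φ : HF) :
    (φ.PolarIn p true → ∀ x, φ.Sat R g (Function.update V p C) x →
      φ.Sat R g (Function.update V p D) x) ∧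
    (φ.PolarIn p false → ∀ x, φ.Sat R g (Function.update V p D) x →
      φ.Sat R g (Function.update V p C) x) := by
  induction φ with
  | bot | top | nom => exact ⟨fun _ _ => id, fun _ _ => id⟩
  | var k =>
    by_cases hk : k = p
    · subst hk
      exact ⟨fun _ x hx => by simpa [Sat] using h (by simpa [Sat] using hx),
        fun hp => nomatch hp rfl⟩
    · simp [Sat, hk]
  | neg φ ih => exact ⟨fun hp x hx hx' => hx (ih.2 hp x hx'), fun hp x hx hx' => hx (ih.1 hp x hx')⟩
  | or φ ψ ih ih' =>
    exact ⟨fun hp x => Or.imp (ih.1 hp.1 x) (ih'.1 hp.2 x),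
      fun hp x => Or.imp (ih.2 hp.1 x) (ih'.2 hp.2 x)⟩
  | and φ ψ ih ih' =>
    exact ⟨fun hp x => And.imp (ih.1 hp.1 x) (ih'.1 hp.2 x),
      fun hp x => And.imp (ih.2 hp.1 x) (ih'.2 hp.2 x)⟩
  | dia φ ih | idia φ ih =>
    exact ⟨fun hp x ⟨v, hv, hs⟩ => ⟨v, hv, ih.1 hp v hs⟩,
      fun hp x ⟨v, hv, hs⟩ => ⟨v, hv, ih.2 hp v hs⟩⟩
  | box φ ih | ibox φ ih =>
    exact ⟨fun hp x hx v hv => ih.1 hp v (hx v hv), fun hp x hx v hv => ih.2 hp v (hx v hv)⟩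

theorem sat_disj (g : ℕ → W) (V : ℕ → Set W) (l : List HF) (x : W) :
    (disj l).Sat R g V x ↔ ∃ φ ∈ l, φ.Sat R g V x := by
  induction l with
  | nil => simp [disj, Sat]
  | cons φ l ih =>
    cases l with
    | nil => simp [disj]
    | cons ψ l => simp [disj, Sat, ih]

theorem sat_conj (g : ℕ → W) (V : ℕ → Set W) (l : List HF) (x : W) :
    (conj l).Sat R g V x ↔ ∀ φ ∈ l, φ.Sat R g V x := by
  induction l with
  | nil => simp [conj, Sat]
  | cons φ l ih =>
    cases l with
    | nil => simp [conj]
    | cons ψ l => simp [conj, Sat, ih]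

theorem synClosed_disj {s : Bool} {l : List HF} (h : ∀ φ ∈ l, φ.SynClosed s) :
    (disj l).SynClosed s := by
  induction l with
  | nil => trivial
  | cons φ l ih =>
    cases l with
    | nil => exact h φ (by simp)
    | cons ψ l => exact ⟨h φ (by simp), ih fun χ hχ => h χ (List.mem_cons_of_mem _ hχ)⟩

theorem notMem_vars_disj {p : ℕ} {l : List HF} (h : ∀ φ ∈ l, p ∉ φ.vars) : p ∉ (disj l).vars := by
  induction l with
  | nil => simp [disj, vars]
  | cons φ l ih =>
    cases l with
    | nil => exact h φ (by simp)
    | cons ψ l =>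
      simp only [disj, vars, Finset.mem_union, not_or]
      exact ⟨h φ (by simp), ih fun χ hχ => h χ (List.mem_cons_of_mem _ hχ)⟩

theorem Pure.subst {φ : HF} (hφ : φ.Pure) (p : ℕ) (A : HF) : (HF.subst p A φ).Pure := by
  induction φ with
  | bot | top | nom => trivial
  | var k => exact hφ.elim
  | neg φ ih | dia φ ih | box φ ih | idia φ ih | ibox φ ih => exact ih hφ
  | or φ ψ ih ih' | and φ ψ ih ih' => exact ⟨ih hφ.1, ih' hφ.2⟩

/-- Substitution of `A` for a variable of one polarity in a syntactically closed or open formula: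
only the kind of `A` matching the polarity matters. -/
theorem SynClosed.subst_polar {s t : Bool} {φ A : HF} {p : ℕ} (hφ : φ.SynClosed s)
    (hp : φ.PolarIn p t) (hA : A.SynClosed (s == t)) : (HF.subst p A φ).SynClosed s := by
  induction φ generalizing s t with
  | bot | top => trivial
  | nom => exact hφ
  | var k =>
    by_cases hk : k = p
    · obtain rfl : t = true := hp hk
      simpa [HF.subst, hk] using hA
    · simp [HF.subst, hk, SynClosed]
  | neg φ ih => exact ih (s := !s) (t := !t) hφ hp (by cases s <;> cases t <;> exact hA)
  | dia φ ih | box φ ih => exact ih (s := s) hφ hp hA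
  | idia φ ih | ibox φ ih => exact ⟨hφ.1, ih hφ.2 hp hA⟩
  | or φ ψ ih ih' | and φ ψ ih ih' => exact ⟨ih hφ.1 hp.1 hA, ih' hφ.2 hp.2 hA⟩

theorem SynClosed.subst {s : Bool} {φ A : HF} (p : ℕ) (hφ : φ.SynClosed s)
    (hA : ∀ t, A.SynClosed t) : (HF.subst p A φ).SynClosed s := by
  induction φ generalizing s with
  | bot | top => trivial
  | nom => exact hφ
  | var k =>
    by_cases hk : k = p
    · simpa [HF.subst, hk] using hA s
    · simp [HF.subst, hk, SynClosed]
  | neg φ ih => exact ih (s := !s) hφ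
  | dia φ ih | box φ ih => exact ih (s := s) hφ
  | idia φ ih | ibox φ ih => exact ⟨hφ.1, ih hφ.2⟩
  | or φ ψ ih ih' | and φ ψ ih ih' => exact ⟨ih hφ.1, ih' hφ.2⟩

theorem synClosed_ofML (s : Bool) (φ : ML) : (ofML φ).SynClosed s := by
  induction φ generalizing s with
  | bot | top | var => trivial
  | neg φ ih => exact ih (!s)
  | dia φ ih | box φ ih => exact ih s
  | or φ ψ ih ih' | and φ ψ ih ih' => exact ⟨ih s, ih' s⟩

/-- The shape of equations kept by the algorithm: pure, or syntactically open. -/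
def PureOrOpen (φ : HF) : Prop := φ.Pure ∨ φ.SynClosed false

end HF

/-! ### Auxiliary rules -/

section Rewriting

variable {W : Type u} {R : W → W → Prop}

theorem Tacit.sat_iff {a b : HF} (h : Tacit a b) (g : ℕ → W) (V : ℕ → Set W) (x : W) :
    a.Sat R g V x ↔ b.Sat R g V x := by
  cases h <;> simp only [HF.Sat] <;> first | tauto | grind

theorem Rewrite.sat_iff {a b : HF} (h : Rewrite a b) (g : ℕ → W) (V : ℕ → Set W) (x : W) :
    a.Sat R g V x ↔ b.Sat R g V x := by
  induction h generalizing x with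
  | tacit h => exact h.sat_iff g V x
  | tacit_symm h => exact (h.sat_iff g V x).symm
  | or_neg a | and_neg a | or_top a | or_bot a | and_top a | and_bot a =>
    simp only [HF.Sat]; tauto
  | neg _ ih | or_left _ _ ih | or_right _ _ ih | and_left _ _ ih | and_right _ _ ih | dia _ ih
  | box _ ih | idia _ ih | ibox _ ih => simp only [HF.Sat, ih]

theorem Tacit.synClosed_iff {a b : HF} (h : Tacit a b) (s : Bool) :
    a.SynClosed s ↔ b.SynClosed s := by
  cases h <;> simp only [HF.SynClosed, Bool.not_not, Bool.not_eq_true', Bool.not_eq_false'] <;> tauto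

theorem Tacit.pure_iff {a b : HF} (h : Tacit a b) : a.Pure ↔ b.Pure := by
  cases h <;> simp only [HF.Pure] <;> tauto

theorem Rewrite.synClosed {a b : HF} (h : Rewrite a b) {s : Bool} (ha : a.SynClosed s) :
    b.SynClosed s := by
  induction h generalizing s with
  | tacit h => exact (h.synClosed_iff s).1 ha
  | tacit_symm h => exact (h.synClosed_iff s).2 ha
  | or_neg a | and_neg a | or_top a | and_bot a => trivial
  | or_bot a | and_top a => exact ha.1
  | neg _ ih => exact ih (s := !s) ha
  | dia _ ih | box _ ih => exact ih (s := s) ha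
  | or_left _ _ ih | and_left _ _ ih => exact ⟨ih ha.1, ha.2⟩
  | or_right _ _ ih | and_right _ _ ih | idia _ ih | ibox _ ih => exact ⟨ha.1, ih ha.2⟩

theorem Rewrite.pure {a b : HF} (h : Rewrite a b) (ha : a.Pure) : b.Pure := by
  induction h with
  | tacit h => exact h.pure_iff.1 ha
  | tacit_symm h => exact h.pure_iff.2 ha
  | or_neg a | and_neg a | or_top a | and_bot a => trivial
  | or_bot a | and_top a => exact ha.1
  | neg _ ih | dia _ ih | box _ ih | idia _ ih | ibox _ ih => exact ih ha
  | or_left _ _ ih | and_left _ _ ih => exact ⟨ih ha.1, ha.2⟩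
  | or_right _ _ ih | and_right _ _ ih => exact ⟨ha.1, ih ha.2⟩

/-- The shifting of boxes is sound only for equations holding in the whole model, whence the
quantifier over worlds on each side. -/
theorem EqRule.forall_sat_iff {e : Equation} {es : List Equation} (h : EqRule e es) (g : ℕ → W)
    (V : ℕ → Set W) :
    (∀ x, e.toHF.Sat R g V x) ↔ ∀ e' ∈ es, ∀ x, e'.toHF.Sat R g V x := by
  cases h with
  | rewrite_left _ h | rewrite_right _ h | rewrite_fml h =>
    simp [Equation.toHF, HF.Sat, h.sat_iff]
  | and_rule β γ δ =>
    simp only [Equation.toHF, HF.Sat, List.forall_mem_cons, List.not_mem_nil, false_imp_iff,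
      implies_true, and_true, ← forall_and]
    exact forall_congr' fun x => by tauto
  | box_left_shift γ δ | box_right_shift γ δ =>
    simp only [Equation.toHF, HF.Sat, List.forall_mem_cons, List.not_mem_nil, false_imp_iff,
      implies_true, and_true]
    grind
  | or_left_shift | or_right_shift | imp_bot | imp_top | bot_imp | top_imp | fml_top_imp | imp_fml
  | drop_top =>
    simp [Equation.toHF, HF.Sat] <;> exact forall_congr' fun x => by tauto

theorem EqRule.pureOrOpen {e : Equation} {es : List Equation} (h : EqRule e es)
    (he : e.toHF.PureOrOpen) : ∀ e' ∈ es, e'.toHF.PureOrOpen := by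
  cases h with
  | rewrite_left _ h =>
    simpa [Equation.toHF, HF.PureOrOpen] using
      he.imp (fun h' => ⟨h.pure h'.1, h'.2⟩) (fun h' => ⟨h.synClosed (s := true) h'.1, h'.2⟩)
  | rewrite_right _ h =>
    simpa [Equation.toHF, HF.PureOrOpen] using
      he.imp (fun h' => ⟨h'.1, h.pure h'.2⟩) (fun h' => ⟨h'.1, h.synClosed (s := false) h'.2⟩)
  | rewrite_fml h =>
    simpa [Equation.toHF, HF.PureOrOpen] using he.imp h.pure h.synClosed
  | _ =>
    simp [Equation.toHF, HF.PureOrOpen, HF.Pure, HF.SynClosed] at he ⊢ <;> tauto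

end Rewriting

/-! ### Satisfiability of systems and its invariance under the rules -/

theorem Equation.toHF_subst (p : ℕ) (A : HF) (e : Equation) :
    (e.subst p A).toHF = HF.subst p A e.toHF := by
  cases e <;> rfl

theorem Step.pureOrOpen {E E' : System} (h : Step E E') (hE : ∀ e ∈ E, e.toHF.PureOrOpen) :
    ∀ e ∈ E', e.toHF.PureOrOpen := by
  have subst_mem : ∀ {E : System} (p : ℕ) (A : HF), (∀ e ∈ E, e.toHF.PureOrOpen) →
      (∀ t, A.SynClosed t) → ∀ e ∈ E.map (Equation.subst p A), e.toHF.PureOrOpen := by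
    intro E p A hE hA e he
    obtain ⟨e, he', rfl⟩ := List.mem_map.1 he
    rw [Equation.toHF_subst]
    exact (hE e he').imp (fun h => h.subst p A) (fun h => h.subst p hA)
  cases h with
  | perm h => exact fun e he => hE e (h.mem_iff.2 he)
  | eq_rule e es E h =>
    rw [List.forall_mem_cons] at hE
    intro e' he'
    exact (List.mem_append.1 he').elim (h.pureOrOpen hE.1 e') (hE.2 e')
  | dia_rule j k γ E hk hfresh =>
    simp only [List.forall_mem_cons] at hE ⊢
    -- The new equation `𝐣 → ◇𝐤` has a positive nominal, but it is pure.
    exact ⟨.inl ⟨trivial, trivial⟩, hE.1.imp (fun h => ⟨trivial, h.2⟩) (fun h => ⟨rfl, h.2⟩), hE.2⟩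
  | ackermann p A B hA hB =>
    intro e he
    obtain ⟨e, he', rfl⟩ := List.mem_map.1 he
    rw [Equation.toHF_subst]
    refine (hE e (by simp [he'])).imp (fun h => h.subst p _) (fun h => ?_)
    refine h.subst_polar (hB e he') (HF.synClosed_disj fun α hα => ?_)
    have := hE (.imp α (.var p)) (by simpa using .inl hα)
    exact this.elim (fun h => h.2.elim) (fun h => h.1)
  | switch p E => exact subst_mem p _ hE fun t => trivial
  | elim_pos p E _ | elim_neg p E _ => exact subst_mem p _ hE fun t => trivial

section Satisfiable

variable {W : Type u}

/-- The system `E` holds in the whole of some model on `(W, R)` with admissible valuation, where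
the reserved nominal names `w`. -/
def Satisfiable (R : W → W → Prop) (Adm : Set (Set W)) (w : W) (E : System) : Prop :=
  ∃ (g : ℕ → W) (V : ℕ → Set W), g 0 = w ∧ (∀ k, V k ∈ Adm) ∧
    ∀ e ∈ E, ∀ x, e.toHF.Sat R g V x

/-- The non-trivial half of Ackermann's lemma, for a syntactically closed formula `α`: if `α` can be
substituted for a variable in which a system is negative, then the value of `α` is
contained in an admissible set that can serve as the value of that variable. -/
def HasAckermann (R : W → W → Prop) (Adm : Set (Set W)) : Prop :=
  ∀ (g : ℕ → W) (V : ℕ → Set W) (p : ℕ) (α : HF) (B : System), (∀ k, V k ∈ Adm) →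
    α.SynClosed true → (∀ e ∈ B, e.toHF.PureOrOpen) → (∀ e ∈ B, e.toHF.PolarIn p false) →
    (∀ e ∈ B, ∀ x, e.toHF.Sat R g (Function.update V p {y | α.Sat R g V y}) x) →
    ∃ C ∈ Adm, {y | α.Sat R g V y} ⊆ C ∧
      ∀ e ∈ B, ∀ x, e.toHF.Sat R g (Function.update V p C) x

theorem hasAckermann_univ (R : W → W → Prop) : HasAckermann R Set.univ :=
  fun _ _ _ _ _ _ _ _ _ h => ⟨_, trivial, subset_rfl, h⟩

theorem update_mem {Adm : Set (Set W)} {V : ℕ → Set W} (hV : ∀ k, V k ∈ Adm) (p : ℕ) {C : Set W}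
    (hC : C ∈ Adm) (k : ℕ) : Function.update V p C k ∈ Adm := by
  by_cases h : k = p
  · subst h; simpa using hC
  · simpa [h] using hV k

theorem Satisfiable.of_subst {R : W → W → Prop} {Adm : Set (Set W)} {w : W} {E : System} {p : ℕ}
    {A : HF} (hA : ∀ g V, (∀ k, V k ∈ Adm) → {y | A.Sat R g V y} ∈ Adm)
    (h : Satisfiable R Adm w (E.map (Equation.subst p A))) : Satisfiable R Adm w E := by
  obtain ⟨g, V, hg, hV, hE⟩ := h
  refine ⟨g, _, hg, update_mem hV p (hA g V hV), fun e he x => ?_⟩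
  rw [← HF.sat_subst, ← Equation.toHF_subst]
  exact hE _ (List.mem_map_of_mem he) x

theorem Step.satisfiable_iff {R : W → W → Prop} {Adm : Set (Set W)} (hempty : ∅ ∈ Adm)
    (hcompl : ∀ X ∈ Adm, Xᶜ ∈ Adm) (hack : HasAckermann R Adm) (w : W) {E E' : System}
    (h : Step E E') (hE : ∀ e ∈ E, e.toHF.PureOrOpen) :
    Satisfiable R Adm w E ↔ Satisfiable R Adm w E' := by
  have huniv : Set.univ ∈ Adm := by simpa using hcompl _ hempty
  cases h with
  | perm h => simp only [Satisfiable, h.mem_iff]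
  | eq_rule e es E h =>
    simp only [Satisfiable, List.forall_mem_cons, List.forall_mem_append, h.forall_sat_iff]
  | dia_rule j k γ E hk hfresh =>
    simp only [List.forall_mem_cons, Equation.toHF, HF.noms, Finset.mem_union,
      Finset.mem_singleton, not_or] at hfresh
    obtain ⟨⟨hkj, hkγ⟩, hkE⟩ := hfresh
    constructor
    · rintro ⟨g, V, hg, hV, hs⟩
      simp only [List.forall_mem_cons] at hs
      obtain ⟨v, hv, hsv⟩ := (hs.1 (g j)).resolve_left (fun h => h rfl)
      have hsat : ∀ {ψ : HF}, k ∉ ψ.noms → ∀ x,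
          ψ.Sat R (Function.update g k v) V x ↔ ψ.Sat R g V x := fun hψ x =>
        HF.sat_congr_noms V (fun i hi => Function.update_of_ne (ne_of_mem_of_not_mem hi hψ) _ _) x
      refine ⟨Function.update g k v, V, by rwa [Function.update_of_ne hk.symm], hV, ?_⟩
      simp only [List.forall_mem_cons]
      refine ⟨fun x => ?_, fun x => ?_, fun e he x => (hsat (hkE e he) x).2 (hs.2 e he x)⟩
      · by_cases hx : x = g j
        · exact .inr ⟨v, hx ▸ hv, by simp [HF.Sat]⟩
        · exact .inl (by simpa [HF.Sat, Function.update_of_ne (Ne.symm hkj)] using hx)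
      · by_cases hx : x = v
        · exact .inr ((hsat hkγ x).2 (hx ▸ hsv))
        · exact .inl (by simpa [HF.Sat] using hx)
    · rintro ⟨g, V, hg, hV, hs⟩
      simp only [List.forall_mem_cons] at hs
      refine ⟨g, V, hg, hV, List.forall_mem_cons.2 ⟨fun x => ?_, hs.2.2⟩⟩
      refine (hs.1 x).imp_right ?_
      rintro ⟨v, hv, hvk⟩
      exact ⟨v, hv, (hs.2.1 v).resolve_left (fun h => h hvk)⟩
  | ackermann p A B hA hB =>
    have hpA := HF.notMem_vars_disj hA
    have hcl : (HF.disj A).SynClosed true := HF.synClosed_disj fun α hα =>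
      (hE (.imp α (.var p)) (by simpa using .inl hα)).elim (fun h => h.2.elim) (fun h => h.1)
    -- As `p` does not occur in `⋁ A`, a change of the value of `p` does not affect `⋁ A`.
    have hfix : ∀ (g : ℕ → W) (V : ℕ → Set W) (C : Set W) (x : W),
        (HF.disj A).Sat R g (Function.update V p C) x ↔ (HF.disj A).Sat R g V x := fun g V C x =>
      HF.sat_congr_vars g (fun k hk => Function.update_of_ne (ne_of_mem_of_not_mem hk hpA) _ _) x
    constructor
    · rintro ⟨g, V, hg, hV, hs⟩
      refine ⟨g, V, hg, hV, fun e he x => ?_⟩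
      obtain ⟨e, he', rfl⟩ := List.mem_map.1 he
      rw [Equation.toHF_subst, HF.sat_subst]
      have hsub : {y | (HF.disj A).Sat R g V y} ⊆ V p := by
        intro y hy
        obtain ⟨α, hα, hαy⟩ := (HF.sat_disj g V A y).1 hy
        exact (hs (.imp α (.var p)) (by simpa using .inl hα) y).resolve_left (fun h => h hαy)
      refine (HF.sat_mono_polar g V p hsub e.toHF).2 (hB e he') x ?_
      rw [Function.update_eq_self]
      exact hs e (by simp [he']) x
    · rintro ⟨g, V, hg, hV, hs⟩
      obtain ⟨C, hC, hAC, hBC⟩ := hack g V p (HF.disj A) B hV hcl (fun e he => hE e (by simp [he]))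
        hB fun e he x => by
          rw [← HF.sat_subst, ← Equation.toHF_subst]
          exact hs _ (List.mem_map_of_mem he) x
      refine ⟨g, _, hg, update_mem hV p hC, List.forall_mem_append.2 ⟨?_, hBC⟩⟩
      intro e he x
      obtain ⟨α, hα, rfl⟩ := List.mem_map.1 he
      by_cases hx : α.Sat R g (Function.update V p C) x
      · refine .inr ?_
        have : x ∈ C := hAC ((hfix g V C x).1 ((HF.sat_disj _ _ _ _).2 ⟨α, hα, hx⟩))
        simpa [HF.Sat] using this
      · exact .inl hx
  | switch p E =>
    refine ⟨?_, Satisfiable.of_subst fun g V hV => hcompl _ (hV p)⟩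
    rintro ⟨g, V, hg, hV, hs⟩
    refine ⟨g, _, hg, update_mem hV p (hcompl _ (hV p)), fun e he x => ?_⟩
    obtain ⟨e, he', rfl⟩ := List.mem_map.1 he
    rw [Equation.toHF_subst, HF.sat_subst]
    have : {y | (HF.var p).neg.Sat R g (Function.update V p (V p)ᶜ) y} = V p := by
      ext y; simp [HF.Sat]
    rw [this, Function.update_idem, Function.update_eq_self]
    exact hs e he' x
  | elim_pos p E hp =>
    refine ⟨?_, Satisfiable.of_subst fun g V hV => by simpa [HF.Sat] using huniv⟩
    rintro ⟨g, V, hg, hV, hs⟩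
    refine ⟨g, V, hg, hV, fun e he x => ?_⟩
    obtain ⟨e, he', rfl⟩ := List.mem_map.1 he
    rw [Equation.toHF_subst, HF.sat_subst]
    refine (HF.sat_mono_polar g V p (C := V p) (fun _ _ => trivial) e.toHF).1 (hp e he') x ?_
    rw [Function.update_eq_self]
    exact hs e he' x
  | elim_neg p E hp =>
    refine ⟨?_, Satisfiable.of_subst fun g V hV => by simpa [HF.Sat] using hempty⟩
    rintro ⟨g, V, hg, hV, hs⟩
    refine ⟨g, V, hg, hV, fun e he x => ?_⟩
    obtain ⟨e, he', rfl⟩ := List.mem_map.1 he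
    rw [Equation.toHF_subst, HF.sat_subst]
    refine (HF.sat_mono_polar g V p (D := V p) (fun _ h => h.elim) e.toHF).2 (hp e he') x ?_
    rw [Function.update_eq_self]
    exact hs e he' x

/-- The formula `α` is true at `w` in some admissible model iff the pure system to which
SQEMA reduces `𝐢 → α` is satisfiable. -/
theorem satisfiable_iff_of_steps {R : W → W → Prop} {Adm : Set (Set W)} (hempty : ∅ ∈ Adm)
    (hcompl : ∀ X ∈ Adm, Xᶜ ∈ Adm) (hack : HasAckermann R Adm) (w : W) {α : ML} {E : System}
    (h : Relation.ReflTransGen Step [.imp (.nom 0) (HF.ofML α)] E) (hE : E.toHF.Pure) :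
    (∃ V : ℕ → Set W, (∀ k, V k ∈ Adm) ∧ α.Sat R V w) ↔
      ∃ g : ℕ → W, g 0 = w ∧ ∀ x, E.toHF.Sat R g (fun _ => ∅) x := by
  have key : (∀ e ∈ E, e.toHF.PureOrOpen) ∧
      (Satisfiable R Adm w [.imp (.nom 0) (HF.ofML α)] ↔ Satisfiable R Adm w E) := by
    clear hE
    induction h with
    | refl =>
      refine ⟨?_, Iff.rfl⟩
      simpa using .inr ⟨rfl, HF.synClosed_ofML _ _⟩
    | tail _ hs ih =>
      exact ⟨hs.pureOrOpen ih.1, ih.2.trans (hs.satisfiable_iff hempty hcompl hack w ih.1)⟩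
  have hstart : (∃ V : ℕ → Set W, (∀ k, V k ∈ Adm) ∧ α.Sat R V w) ↔
      Satisfiable R Adm w [.imp (.nom 0) (HF.ofML α)] := by
    constructor
    · rintro ⟨V, hV, hs⟩
      refine ⟨fun _ => w, V, rfl, hV, ?_⟩
      simp only [List.mem_singleton, forall_eq, Equation.toHF, HF.Sat, HF.sat_ofML]
      intro x
      by_cases hx : x = w
      · exact .inr (hx ▸ hs)
      · exact .inl hx
    · rintro ⟨g, V, hg, hV, hs⟩
      refine ⟨V, hV, ?_⟩
      have := (hs _ (List.mem_singleton_self _) w).resolve_left (fun h => h hg.symm)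
      exact (HF.sat_ofML g V α w).1 this
  rw [hstart, key.2]
  have hconj : ∀ g V, (∀ e ∈ E, ∀ x, e.toHF.Sat R g V x) ↔ ∀ x, E.toHF.Sat R g V x := by
    intro g V
    simp only [System.toHF, HF.sat_conj, List.forall_mem_map]
    exact ⟨fun h x e he => h e he x, fun h e he x => h x e he⟩
  constructor
  · rintro ⟨g, V, hg, -, hs⟩
    exact ⟨g, hg, fun x => (hE.sat_congr g V _ x).1 ((hconj g V).1 hs x)⟩
  · rintro ⟨g, hg, hs⟩
    exact ⟨g, _, hg, fun _ => hempty, (hconj g _).2 hs⟩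

end Satisfiable

/-! ### Preprocessing -/

namespace ML

variable {W : Type u} {R : W → W → Prop}

theorem sat_nnf (V : ℕ → Set W) (φ : ML) (x : W) :
    ((nnf true φ).Sat R V x ↔ φ.Sat R V x) ∧ ((nnf false φ).Sat R V x ↔ ¬ φ.Sat R V x) := by
  induction φ generalizing x <;> simp_all [nnf, Sat]; tauto

theorem Distribute.sat_iff {φ ψ : ML} (h : Distribute φ ψ) (V : ℕ → Set W) (x : W) :
    φ.Sat R V x ↔ ψ.Sat R V x := by
  induction h generalizing x with
  | dia_or a b => simp only [Sat]; grind
  | or_and a b c | and_or a b c => simp only [Sat]; tauto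
  | or_left _ _ ih | or_right _ _ ih | and_left _ _ ih | and_right _ _ ih | dia _ ih
  | box _ ih => simp only [Sat, ih]

theorem sat_disjuncts (V : ℕ → Set W) (φ : ML) (x : W) :
    (∃ α ∈ φ.disjuncts, α.Sat R V x) ↔ φ.Sat R V x := by
  induction φ with
  | or φ ψ ih ih' =>
    simp only [disjuncts, List.mem_append, Sat, ← ih, ← ih', or_and_right, exists_or]
  | _ => simp [disjuncts]

end ML

theorem Preprocess.sat_iff {W : Type u} {R : W → W → Prop} {φ : ML} {as : List ML}
    (h : Preprocess φ as) (V : ℕ → Set W) (x : W) :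
    φ.Sat R V x ↔ ∀ α ∈ as, ¬ α.Sat R V x := by
  obtain ⟨ψ, hψ, -, rfl⟩ := h
  have hdist : (ML.nnf false φ).Sat R V x ↔ ψ.Sat R V x := by
    induction hψ with
    | refl => rfl
    | tail _ hs ih => exact ih.trans (hs.sat_iff V x)
  have := ML.sat_disjuncts (R := R) V ψ x
  rw [← hdist, (ML.sat_nnf V φ x).2] at this
  rw [← not_iff_not, ← this]
  push Not
  rfl

theorem Preprocess.forall_sat_iff {W : Type u} {R : W → W → Prop} {φ : ML} {as : List ML}
    (h : Preprocess φ as) (Adm : Set (Set W)) (w : W) :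
    (∀ V : ℕ → Set W, (∀ k, V k ∈ Adm) → φ.Sat R V w) ↔
      ∀ α ∈ as, ¬ ∃ V : ℕ → Set W, (∀ k, V k ∈ Adm) ∧ α.Sat R V w := by
  simp only [h.sat_iff]
  grind

/-! ### The topology of a descriptive frame -/

namespace GeneralFrame

variable {W : Type u} (F : GeneralFrame W)

theorem univ_mem : Set.univ ∈ F.Adm := by simpa using F.compl_mem _ F.empty_mem

theorem inter_mem {X Y : Set W} (hX : X ∈ F.Adm) (hY : Y ∈ F.Adm) : X ∩ Y ∈ F.Adm := by
  simpa [Set.compl_union] using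
    F.compl_mem _ (F.union_mem _ (F.compl_mem _ hX) _ (F.compl_mem _ hY))

theorem box_mem {X : Set W} (hX : X ∈ F.Adm) : {w | ∀ v, F.R w v → v ∈ X} ∈ F.Adm := by
  have h := F.compl_mem _ (F.dia_mem _ (F.compl_mem _ hX))
  convert h using 1
  ext w
  simp

theorem isTopologicalBasis_generateFrom :
    letI := TopologicalSpace.generateFrom F.Adm
    TopologicalSpace.IsTopologicalBasis F.Adm :=
  letI := TopologicalSpace.generateFrom F.Adm
  { exists_subset_inter := fun X hX Y hY _ hx => ⟨X ∩ Y, F.inter_mem hX hY, hx, subset_rfl⟩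
    sUnion_eq := Set.eq_univ_of_univ_subset (Set.subset_sUnion_of_mem F.univ_mem)
    eq_generateFrom := rfl }

variable {F} [TopologicalSpace W] (hB : TopologicalSpace.IsTopologicalBasis F.Adm)

include hB

theorem compactSpace (hF : F.Compact) : CompactSpace W := by
  refine ⟨isCompact_generateFrom hB.eq_generateFrom fun P hP hcover => ?_⟩
  by_contra! hfin
  have := hF (compl '' P) (by rintro _ ⟨X, hX, rfl⟩; exact F.compl_mem X (hP hX)) ?_
  · obtain ⟨x, hx⟩ := this
    obtain ⟨X, hX, hxX⟩ := hcover (Set.mem_univ x)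
    exact hx Xᶜ ⟨X, hX, rfl⟩ hxX
  · intro D hD hDfin
    obtain ⟨x, -, hx⟩ := Set.not_subset.1 (hfin (compl '' D)
      (by rintro _ ⟨Y, hY, rfl⟩; obtain ⟨X, hX, rfl⟩ := hD hY; simpa using hX) (hDfin.image _))
    exact ⟨x, fun Y hY => by_contra fun h => hx ⟨Yᶜ, ⟨Y, hY, rfl⟩, h⟩⟩

theorem isClosed_of_mem {X : Set W} (hX : X ∈ F.Adm) : IsClosed X :=
  ⟨hB.isOpen (F.compl_mem X hX)⟩

theorem isClosed_singleton (hF : F.Differentiated) (x : W) : IsClosed {x} := by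
  rw [← isOpen_compl_iff, hB.isOpen_iff]
  intro y hy
  obtain ⟨X, hX, hyX, hxX⟩ := hF y x hy
  exact ⟨X, hX, hyX, fun z hz hzx => hxX (hzx ▸ hz)⟩

theorem isOpen_dia {O : Set W} (hO : IsOpen O) : IsOpen {w | ∃ v, F.R w v ∧ v ∈ O} := by
  rw [hB.isOpen_iff]
  rintro w ⟨v, hv, hvO⟩
  obtain ⟨Y, hY, hvY, hYO⟩ := hB.isOpen_iff.1 hO v hvO
  exact ⟨_, F.dia_mem Y hY, ⟨v, hv, hvY⟩, fun w' ⟨v', h, h'⟩ => ⟨v', h, hYO h'⟩⟩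

theorem isClosed_successors (hF : F.Tight) (x : W) : IsClosed {y | F.R x y} := by
  rw [← isOpen_compl_iff, hB.isOpen_iff]
  intro y hy
  rw [Set.mem_compl_iff, Set.mem_ofPred_eq, hF] at hy
  push Not at hy
  obtain ⟨Y, hY, hyY, hd⟩ := hy
  exact ⟨Y, hY, hyY, fun z hz hxz => hd z hxz hz⟩

theorem isClosed_predecessors (hF : F.Tight) (y : W) : IsClosed {x | F.R x y} := by
  rw [← isOpen_compl_iff, hB.isOpen_iff]
  intro x hx
  rw [Set.mem_compl_iff, Set.mem_ofPred_eq, hF] at hx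
  push Not at hx
  obtain ⟨Y, hY, hyY, hd⟩ := hx
  exact ⟨_, F.compl_mem _ (F.dia_mem Y hY), fun ⟨v, h, h'⟩ => hd v h h',
    fun z hz hzy => hz ⟨y, hzy, hyY⟩⟩

variable [CompactSpace W]

theorem isOpen_box (hF : F.Tight) {O : Set W} (hO : IsOpen O) :
    IsOpen {w | ∀ v, F.R w v → v ∈ O} := by
  rw [hB.isOpen_iff]
  intro w hw
  obtain ⟨Y, hY, hwY, hYO⟩ : ∃ Y ∈ F.Adm, {v | F.R w v} ⊆ Y ∧ Y ⊆ O := by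
    refine (isClosed_successors hB hF w).isCompact.induction_on
      (p := fun s => ∃ Y ∈ F.Adm, s ⊆ Y ∧ Y ⊆ O) ?_ ?_ ?_ ?_
    · exact ⟨∅, F.empty_mem, subset_rfl, Set.empty_subset _⟩
    · rintro s t hst ⟨Y, hY, htY, hYO⟩
      exact ⟨Y, hY, hst.trans htY, hYO⟩
    · rintro s t ⟨Y, hY, hsY, hYO⟩ ⟨Z, hZ, htZ, hZO⟩
      exact ⟨_, F.union_mem Y hY Z hZ, Set.union_subset_union hsY htZ, Set.union_subset hYO hZO⟩
    · intro v hv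
      obtain ⟨Y, hY, hvY, hYO⟩ := hB.isOpen_iff.1 hO v (hw v hv)
      exact ⟨Y, mem_nhdsWithin_of_mem_nhds ((hB.isOpen hY).mem_nhds hvY), Y, hY, subset_rfl, hYO⟩
  exact ⟨_, F.box_mem hY, fun v hv => hwY hv, fun w' hw' v hv => hYO (hw' v hv)⟩

theorem isOpen_ibox (hF : F.Tight) {O : Set W} (hO : IsOpen O) :
    IsOpen {w | ∀ v, F.R v w → v ∈ O} := by
  rw [hB.isOpen_iff]
  intro w hw
  -- No point outside `O` sees `w`; tightness and compactness give one neighbourhood for all.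
  obtain ⟨Y, hY, hwY, hYO⟩ : ∃ Y ∈ F.Adm, w ∈ Y ∧ ∀ u ∈ Oᶜ, ∀ v ∈ Y, ¬ F.R u v := by
    refine hO.isClosed_compl.isCompact.induction_on
      (p := fun s => ∃ Y ∈ F.Adm, w ∈ Y ∧ ∀ u ∈ s, ∀ v ∈ Y, ¬ F.R u v) ?_ ?_ ?_ ?_
    · exact ⟨Set.univ, F.univ_mem, trivial, fun u hu => hu.elim⟩
    · rintro s t hst ⟨Y, hY, hwY, hd⟩
      exact ⟨Y, hY, hwY, fun u hu => hd u (hst hu)⟩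
    · rintro s t ⟨Y, hY, hwY, hd⟩ ⟨Z, hZ, hwZ, hd'⟩
      exact ⟨Y ∩ Z, F.inter_mem hY hZ, ⟨hwY, hwZ⟩, fun u hu v hv =>
        hu.elim (fun h => hd u h v hv.1) (fun h => hd' u h v hv.2)⟩
    · intro u hu
      have huw : ¬ F.R u w := fun h => hu (hw u h)
      rw [hF] at huw
      push Not at huw
      obtain ⟨Y, hY, hwY, hd⟩ := huw
      refine ⟨{x | ∃ v, F.R x v ∧ v ∈ Y}ᶜ, mem_nhdsWithin_of_mem_nhds
        ((hB.isOpen (F.compl_mem _ (F.dia_mem Y hY))).mem_nhds fun ⟨v, h, h'⟩ => hd v h h'),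
        Y, hY, hwY, fun x hx v hv hxv => hx ⟨v, hxv, hv⟩⟩
  exact ⟨Y, hY, hwY, fun v hv u hu => by_contra fun h => hYO u h v hv hu⟩

omit [CompactSpace W] in
theorem isClosed_box {C : Set W} (hC : IsClosed C) : IsClosed {w | ∀ v, F.R w v → v ∈ C} := by
  rw [← isOpen_compl_iff]
  convert isOpen_dia hB hC.isOpen_compl using 1
  ext w
  simp

theorem isClosed_dia (hF : F.Tight) {C : Set W} (hC : IsClosed C) :
    IsClosed {w | ∃ v, F.R w v ∧ v ∈ C} := by
  rw [← isOpen_compl_iff]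
  convert isOpen_box hB hF hC.isOpen_compl using 1
  ext w
  simp

theorem isClosed_idia (hF : F.Tight) {C : Set W} (hC : IsClosed C) :
    IsClosed {w | ∃ v, F.R v w ∧ v ∈ C} := by
  rw [← isOpen_compl_iff]
  convert isOpen_ibox hB hF hC.isOpen_compl using 1
  ext w
  simp

/-- In a descriptive frame, syntactically closed formulae define closed sets and syntactically open
ones open sets, under admissible valuations. -/
theorem isClosed_and_isOpen_sat (hd : F.Differentiated) (ht : F.Tight) (g : ℕ → W)
    {V : ℕ → Set W} (hV : ∀ k, V k ∈ F.Adm) (φ : HF) :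
    (φ.SynClosed true → IsClosed {x | φ.Sat F.R g V x}) ∧
    (φ.SynClosed false → IsOpen {x | φ.Sat F.R g V x}) := by
  induction φ with
  | bot => exact ⟨fun _ => isClosed_empty, fun _ => isOpen_empty⟩
  | top => exact ⟨fun _ => isClosed_univ, fun _ => isOpen_univ⟩
  | var k => exact ⟨fun _ => isClosed_of_mem hB (hV k), fun _ => hB.isOpen (hV k)⟩
  | nom j => exact ⟨fun _ => isClosed_singleton hB hd (g j), fun h => nomatch h⟩
  | neg φ ih => exact ⟨fun h => (ih.2 h).isClosed_compl, fun h => (ih.1 h).isOpen_compl⟩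
  | or φ ψ ih ih' =>
    exact ⟨fun h => (ih.1 h.1).union (ih'.1 h.2), fun h => (ih.2 h.1).union (ih'.2 h.2)⟩
  | and φ ψ ih ih' =>
    exact ⟨fun h => (ih.1 h.1).inter (ih'.1 h.2), fun h => (ih.2 h.1).inter (ih'.2 h.2)⟩
  | dia φ ih => exact ⟨fun h => isClosed_dia hB ht (ih.1 h), fun h => isOpen_dia hB (ih.2 h)⟩
  | box φ ih => exact ⟨fun h => isClosed_box hB (ih.1 h), fun h => isOpen_box hB ht (ih.2 h)⟩
  | idia φ ih => exact ⟨fun h => isClosed_idia hB ht (ih.1 h.2), fun h => nomatch h.1⟩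
  | ibox φ ih => exact ⟨fun h => (nomatch h.1), fun h => isOpen_ibox hB ht (ih.2 h.2)⟩

/-! ### Ackermann's lemma in descriptive frames -/

omit hB [CompactSpace W] in
/-- For an antitone operation `S` with open values at admissible sets, an admissible `C ⊇ A` with
`x ∈ S C` can be chosen uniformly for all `x` in a compact set. -/
theorem exists_adm_of_isCompact {S : Set W → Set W} (hmono : ∀ C D, C ⊆ D → S D ⊆ S C)
    (hopen : ∀ C ∈ F.Adm, IsOpen (S C)) {A K : Set W} (hK : IsCompact K)
    (h : ∀ x ∈ K, ∃ C ∈ F.Adm, A ⊆ C ∧ x ∈ S C) : ∃ C ∈ F.Adm, A ⊆ C ∧ K ⊆ S C := by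
  refine hK.induction_on (p := fun s => ∃ C ∈ F.Adm, A ⊆ C ∧ s ⊆ S C) ?_ ?_ ?_ ?_
  · exact ⟨Set.univ, F.univ_mem, Set.subset_univ _, Set.empty_subset _⟩
  · rintro s t hst ⟨C, hC, hAC, htC⟩
    exact ⟨C, hC, hAC, hst.trans htC⟩
  · rintro s t ⟨C, hC, hAC, hsC⟩ ⟨D, hD, hAD, htD⟩
    exact ⟨C ∩ D, F.inter_mem hC hD, Set.subset_inter hAC hAD, Set.union_subset
      (hsC.trans (hmono _ _ Set.inter_subset_left)) (htD.trans (hmono _ _ Set.inter_subset_right))⟩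
  · intro x hx
    obtain ⟨C, hC, hAC, hxC⟩ := h x hx
    exact ⟨S C, mem_nhdsWithin_of_mem_nhds ((hopen C hC).mem_nhds hxC), C, hC, hAC, subset_rfl⟩

/-- Esakia's lemma: if a closed value `A` of the variable `p` refutes a syntactically closed formula
positive in `p`, or verifies a syntactically open one negative in `p`, then so does some admissible
set containing `A`. -/
theorem exists_adm_sat (hd : F.Differentiated) (ht : F.Tight) (g : ℕ → W)
    {V : ℕ → Set W} (hV : ∀ k, V k ∈ F.Adm) (p : ℕ) {A : Set W} (hA : IsClosed A) (φ : HF) :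
    (φ.SynClosed true → φ.PolarIn p true → ∀ x, ¬ φ.Sat F.R g (Function.update V p A) x →
      ∃ C ∈ F.Adm, A ⊆ C ∧ ¬ φ.Sat F.R g (Function.update V p C) x) ∧
    (φ.SynClosed false → φ.PolarIn p false → ∀ x, φ.Sat F.R g (Function.update V p A) x →
      ∃ C ∈ F.Adm, A ⊆ C ∧ φ.Sat F.R g (Function.update V p C) x) := by
  -- The inductive hypothesis, made uniform over a closed set of worlds.
  have unif_closed : ∀ {φ : HF}, φ.SynClosed true → φ.PolarIn p true → ∀ {K : Set W}, IsClosed K →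
      (∀ x ∈ K, ∃ C ∈ F.Adm, A ⊆ C ∧ ¬ φ.Sat F.R g (Function.update V p C) x) →
      ∃ C ∈ F.Adm, A ⊆ C ∧ ∀ x ∈ K, ¬ φ.Sat F.R g (Function.update V p C) x := by
    intro φ hc hp K hK h
    exact exists_adm_of_isCompact (S := fun C => {x | ¬ φ.Sat F.R g (Function.update V p C) x})
      (fun C D hCD x hx hx' => hx ((HF.sat_mono_polar g V p hCD φ).1 hp x hx'))
      (fun C hC => ((isClosed_and_isOpen_sat hB hd ht g (update_mem hV p hC) φ).1 hc).isOpen_compl)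
      hK.isCompact h
  have unif_open : ∀ {φ : HF}, φ.SynClosed false → φ.PolarIn p false → ∀ {K : Set W}, IsClosed K →
      (∀ x ∈ K, ∃ C ∈ F.Adm, A ⊆ C ∧ φ.Sat F.R g (Function.update V p C) x) →
      ∃ C ∈ F.Adm, A ⊆ C ∧ ∀ x ∈ K, φ.Sat F.R g (Function.update V p C) x := by
    intro φ hc hp K hK h
    exact exists_adm_of_isCompact (S := fun C => {x | φ.Sat F.R g (Function.update V p C) x})
      (fun C D hCD x hx => (HF.sat_mono_polar g V p hCD φ).2 hp x hx)
      (fun C hC => (isClosed_and_isOpen_sat hB hd ht g (update_mem hV p hC) φ).2 hc)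
      hK.isCompact h
  induction φ with
  | bot | top | nom =>
    exact ⟨fun _ _ x hx => ⟨Set.univ, F.univ_mem, Set.subset_univ _, hx⟩,
      fun _ _ x hx => ⟨Set.univ, F.univ_mem, Set.subset_univ _, hx⟩⟩
  | var k =>
    by_cases hk : k = p
    · subst hk
      refine ⟨fun _ _ x hx => ?_, fun _ hp => nomatch hp rfl⟩
      have hxA : x ∈ Aᶜ := by simpa [HF.Sat] using hx
      obtain ⟨Y, hY, hxY, hYA⟩ := hB.isOpen_iff.1 hA.isOpen_compl x hxA
      exact ⟨Yᶜ, F.compl_mem Y hY, Set.subset_compl_comm.1 hYA, by simpa [HF.Sat] using hxY⟩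
    · simp only [HF.Sat, Function.update_of_ne hk]
      exact ⟨fun _ _ x hx => ⟨Set.univ, F.univ_mem, Set.subset_univ _, hx⟩,
        fun _ _ x hx => ⟨Set.univ, F.univ_mem, Set.subset_univ _, hx⟩⟩
  | neg φ ih =>
    refine ⟨fun hc hp x hx => ?_, fun hc hp x hx => ih.1 hc hp x hx⟩
    obtain ⟨C, hC, hAC, h⟩ := ih.2 hc hp x (not_not.1 hx)
    exact ⟨C, hC, hAC, not_not.2 h⟩
  | or φ ψ ih ih' =>
    refine ⟨fun hc hp x hx => ?_, fun hc hp x hx => ?_⟩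
    · obtain ⟨C, hC, hAC, h⟩ := ih.1 hc.1 hp.1 x fun h => hx (.inl h)
      obtain ⟨D, hD, hAD, h'⟩ := ih'.1 hc.2 hp.2 x fun h => hx (.inr h)
      refine ⟨C ∩ D, F.inter_mem hC hD, Set.subset_inter hAC hAD, ?_⟩
      rintro (hs | hs)
      · exact h ((HF.sat_mono_polar g V p Set.inter_subset_left φ).1 hp.1 x hs)
      · exact h' ((HF.sat_mono_polar g V p Set.inter_subset_right ψ).1 hp.2 x hs)
    · rcases hx with hx | hx
      · obtain ⟨C, hC, hAC, h⟩ := ih.2 hc.1 hp.1 x hx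
        exact ⟨C, hC, hAC, .inl h⟩
      · obtain ⟨C, hC, hAC, h⟩ := ih'.2 hc.2 hp.2 x hx
        exact ⟨C, hC, hAC, .inr h⟩
  | and φ ψ ih ih' =>
    refine ⟨fun hc hp x hx => ?_, fun hc hp x hx => ?_⟩
    · rcases not_and_or.1 hx with hx | hx
      · obtain ⟨C, hC, hAC, h⟩ := ih.1 hc.1 hp.1 x hx
        exact ⟨C, hC, hAC, fun hs => h hs.1⟩
      · obtain ⟨C, hC, hAC, h⟩ := ih'.1 hc.2 hp.2 x hx
        exact ⟨C, hC, hAC, fun hs => h hs.2⟩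
    · obtain ⟨C, hC, hAC, h⟩ := ih.2 hc.1 hp.1 x hx.1
      obtain ⟨D, hD, hAD, h'⟩ := ih'.2 hc.2 hp.2 x hx.2
      exact ⟨C ∩ D, F.inter_mem hC hD, Set.subset_inter hAC hAD,
        (HF.sat_mono_polar g V p Set.inter_subset_left φ).2 hp.1 x h,
        (HF.sat_mono_polar g V p Set.inter_subset_right ψ).2 hp.2 x h'⟩
  | dia φ ih =>
    refine ⟨fun hc hp x hx => ?_, fun hc hp x hx => ?_⟩
    · obtain ⟨C, hC, hAC, h⟩ := unif_closed (φ := φ) hc hp (isClosed_successors hB ht x)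
        fun v hv => ih.1 hc hp v fun hs => hx ⟨v, hv, hs⟩
      exact ⟨C, hC, hAC, fun ⟨v, hv, hs⟩ => h v hv hs⟩
    · obtain ⟨v, hv, hs⟩ := hx
      obtain ⟨C, hC, hAC, h⟩ := ih.2 hc hp v hs
      exact ⟨C, hC, hAC, v, hv, h⟩
  | box φ ih =>
    refine ⟨fun hc hp x hx => ?_, fun hc hp x hx => ?_⟩
    · simp only [HF.Sat, not_forall] at hx
      obtain ⟨v, hv, hs⟩ := hx
      obtain ⟨C, hC, hAC, h⟩ := ih.1 hc hp v hs
      exact ⟨C, hC, hAC, fun hs => h (hs v hv)⟩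
    · exact unif_open (φ := φ) hc hp (isClosed_successors hB ht x)
        fun v hv => ih.2 hc hp v (hx v hv)
  | idia φ ih =>
    refine ⟨fun hc hp x hx => ?_, fun hc => nomatch hc.1⟩
    obtain ⟨C, hC, hAC, h⟩ := unif_closed (φ := φ) hc.2 hp (isClosed_predecessors hB ht x)
      fun v hv => ih.1 hc.2 hp v fun hs => hx ⟨v, hv, hs⟩
    exact ⟨C, hC, hAC, fun ⟨v, hv, hs⟩ => h v hv hs⟩
  | ibox φ ih =>
    refine ⟨fun hc => (nomatch hc.1), fun hc hp x hx => ?_⟩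
    exact unif_open (φ := φ) hc.2 hp (isClosed_predecessors hB ht x)
      fun v hv => ih.2 hc.2 hp v (hx v hv)

theorem hasAckermann_of_basis (hd : F.Differentiated) (ht : F.Tight) :
    HasAckermann F.R F.Adm := by
  intro g V p α B hV hα hBo hBp hB'
  have hA := (isClosed_and_isOpen_sat hB hd ht g hV α).1 hα
  set A := {y | α.Sat F.R g V y}
  induction B with
  | nil => exact ⟨Set.univ, F.univ_mem, Set.subset_univ _, by simp⟩
  | cons e B ih =>
    rw [List.forall_mem_cons] at hBo hBp hB'
    obtain ⟨D, hD, hAD, hBD⟩ := ih hBo.2 hBp.2 hB'.2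
    obtain ⟨C, hC, hAC, heC⟩ : ∃ C ∈ F.Adm, A ⊆ C ∧
        ∀ x, e.toHF.Sat F.R g (Function.update V p C) x := by
      rcases hBo.1 with hpure | hopen
      · exact ⟨Set.univ, F.univ_mem, Set.subset_univ _,
          fun x => (hpure.sat_congr g _ _ x).1 (hB'.1 x)⟩
      · obtain ⟨C, hC, hAC, h⟩ := exists_adm_of_isCompact (A := A)
          (S := fun C => {x | e.toHF.Sat F.R g (Function.update V p C) x})
          (fun C D hCD x hx => (HF.sat_mono_polar g V p hCD e.toHF).2 hBp.1 x hx)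
          (fun C hC => (isClosed_and_isOpen_sat hB hd ht g (update_mem hV p hC) _).2 hopen)
          isCompact_univ
          fun x _ => (exists_adm_sat hB hd ht g hV p hA e.toHF).2 hopen hBp.1 x (hB'.1 x)
        exact ⟨C, hC, hAC, fun x => h trivial⟩
    refine ⟨C ∩ D, F.inter_mem hC hD, Set.subset_inter hAC hAD, List.forall_mem_cons.2
      ⟨fun x => (HF.sat_mono_polar g V p Set.inter_subset_left _).2 hBp.1 x (heC x), ?_⟩⟩
    exact fun e' he' x =>
      (HF.sat_mono_polar g V p Set.inter_subset_right _).2 (hBp.2 e' he') x (hBD e' he' x)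

omit hB [TopologicalSpace W] [CompactSpace W] in
theorem Descriptive.hasAckermann (hF : F.Descriptive) : HasAckermann F.R F.Adm := by
  let := TopologicalSpace.generateFrom F.Adm
  have hB := F.isTopologicalBasis_generateFrom
  have := compactSpace hB hF.2.2
  exact hasAckermann_of_basis hB hF.1 hF.2.1

end GeneralFrame

/-! ### The first-order output -/

section FirstOrder

open FirstOrder.Language

variable {W : Type u} (R : W → W → Prop)

theorem elim_snoc_lift (v : ℕ → W) {n : ℕ} (xs : Fin n → W) (a : W) (x : ℕ ⊕ Fin n) :
    Sum.elim v (Fin.snoc xs a : Fin (n + 1) → W) (lift x) = Sum.elim v xs x := by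
  cases x <;> simp [lift]

theorem elim_snoc_newest (v : ℕ → W) {n : ℕ} (xs : Fin n → W) (a : W) :
    Sum.elim v (Fin.snoc xs a : Fin (n + 1) → W) (newest n) = a := by
  simp [newest]

theorem realize_accF (v : ℕ → W) {n : ℕ} (xs : Fin n → W) (x y : ℕ ⊕ Fin n) :
    letI := frameStructure R
    (accF x y).Realize v xs ↔ R (Sum.elim v xs x) (Sum.elim v xs y) := by
  let := frameStructure R
  exact BoundedFormula.realize_rel₂

theorem realize_ST {φ : HF} (h : φ.Pure) (v : ℕ → W) (V : ℕ → Set W) {n : ℕ} (xs : Fin n → W)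
    (x : ℕ ⊕ Fin n) :
    letI := frameStructure R
    (ST φ h x).Realize v xs ↔ φ.Sat R v V (Sum.elim v xs x) := by
  let := frameStructure R
  induction φ generalizing n with
  | bot => rfl
  | top => exact iff_of_true (BoundedFormula.realize_top.2 trivial) trivial
  | var k => exact h.elim
  | nom j => rfl
  | neg φ ih => exact not_congr (ih h xs x)
  | or φ ψ ih ih' => exact BoundedFormula.realize_sup.trans (or_congr (ih h.1 xs x) (ih' h.2 xs x))
  | and φ ψ ih ih' =>
    exact BoundedFormula.realize_inf.trans (and_congr (ih h.1 xs x) (ih' h.2 xs x))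
  | dia φ ih | idia φ ih =>
    refine BoundedFormula.realize_ex.trans (exists_congr fun a =>
      BoundedFormula.realize_inf.trans (and_congr ?_ ?_))
    · rw [realize_accF, elim_snoc_lift, elim_snoc_newest]
    · exact (ih h _ _).trans (by rw [elim_snoc_newest])
  | box φ ih | ibox φ ih =>
    refine BoundedFormula.realize_all.trans (forall_congr' fun a =>
      BoundedFormula.realize_imp.trans (imp_congr ?_ ?_))
    · rw [realize_accF, elim_snoc_lift, elim_snoc_newest]
    · exact (ih h _ _).trans (by rw [elim_snoc_newest])

theorem realize_existsNotST {φ : HF} (h : φ.Pure) (v : ℕ → W) (V : ℕ → Set W) :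
    letI := frameStructure R
    (existsNotST φ h).Realize v ↔ ∃ x, ¬ φ.Sat R v V x := by
  let := frameStructure R
  refine BoundedFormula.realize_ex.trans (exists_congr fun a => not_congr ?_)
  rw [realize_ST R h v V, elim_snoc_newest]

/-- The output for a pure formula says that it is not true in the whole model, however the nominals
other than the reserved one are interpreted. -/
theorem realize_output {φ : HF} (h : φ.Pure) (w : W) (V : ℕ → Set W) :
    letI := frameStructure R
    (output φ h).Realize (fun _ => w) ↔ ¬ ∃ g : ℕ → W, g 0 = w ∧ ∀ x, φ.Sat R g V x := by
  classical
  let := frameStructure R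
  rw [output, Formula.realize_iAlls]
  simp only [Formula.realize_relabel, realize_existsNotST R h _ V]
  constructor
  · rintro hall ⟨g, hg, hs⟩
    obtain ⟨x, hx⟩ := hall fun j => g j
    refine hx ((HF.sat_congr_noms V (fun j hj => ?_) x).1 (hs x))
    by_cases h0 : j = 0
    · subst h0; simpa using hg
    · simp [h0, hj]
  · intro hno y
    by_contra! hs
    exact hno ⟨_, by simp, hs⟩

theorem realize_conjFO (l : List (L0.Formula Unit)) (v : Unit → W) :
    letI := frameStructure R
    (conjFO l).Realize v ↔ ∀ χ ∈ l, χ.Realize v := by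
  let := frameStructure R
  induction l with
  | nil => simp [conjFO]
  | cons χ l ih =>
    cases l with
    | nil => simp [conjFO]
    | cons χ' l => simp only [conjFO, Formula.realize_inf, ih, List.forall_mem_cons]

end FirstOrder

/-- On every frame whose admissible sets satisfy Ackermann's lemma, the formula returned by SQEMA
expresses local validity of the input. -/
theorem Returns.realize_iff {W : Type u} {R : W → W → Prop} {Adm : Set (Set W)}
    (hempty : ∅ ∈ Adm) (hcompl : ∀ X ∈ Adm, Xᶜ ∈ Adm) (hack : HasAckermann R Adm) (w : W)
    {φ : ML} {χ : L0.Formula Unit} (h : Returns φ χ) :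
    (∀ V : ℕ → Set W, (∀ k, V k ∈ Adm) → φ.Sat R V w) ↔
      @FirstOrder.Language.Formula.Realize L0 W (frameStructure R) Unit χ (fun _ => w) := by
  obtain ⟨as, χs, hpre, hbr, rfl⟩ := h
  rw [hpre.forall_sat_iff, realize_conjFO]
  clear hpre
  induction hbr with
  | nil => simp
  | @cons α χ as χs hα _ ih =>
    obtain ⟨E, hE, hpure, rfl⟩ := hα
    rw [List.forall_mem_cons, List.forall_mem_cons, ih, realize_output R hpure w fun _ => ∅,
      satisfiable_iff_of_steps hempty hcompl hack w hE hpure]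

theorem Returns.localCorrespondent {φ : ML} {χ : L0.Formula Unit} (h : Returns φ χ) :
    LocalCorrespondent.{u} χ φ := by
  intro W R w
  rw [← h.realize_iff (Set.mem_univ _) (fun _ _ => Set.mem_univ _) (hasAckermann_univ R) w]
  simp [ValidAt]

theorem Succeeds.locallyDPersistent {φ : ML} (h : Succeeds φ) : LocallyDPersistent.{u} φ := by
  obtain ⟨χ, hχ⟩ := h
  intro W F hF w
  exact (hχ.realize_iff F.empty_mem F.compl_mem hF.hasAckermann w).trans
    (hχ.localCorrespondent W F.R w).symm

/-! ### Maximal consistent sets -/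

/-- Assignments of truth values to all formulae that respect the Boolean connectives. -/
structure TruthAssignment (v : ML → Prop) : Prop where
  bot : ¬ v .bot
  top : v .top
  neg : ∀ a, v (.neg a) ↔ ¬ v a
  or : ∀ a b, v (.or a b) ↔ (v a ∨ v b)
  and : ∀ a b, v (.and a b) ↔ (v a ∧ v b)

namespace TruthAssignment

variable {v : ML → Prop} (hv : TruthAssignment v)
include hv

theorem imp (a b : ML) : v (.imp a b) ↔ (v a → v b) := by
  rw [ML.imp, hv.or, hv.neg, imp_iff_not_or]

theorem iff (a b : ML) : v (.iff a b) ↔ (v a ↔ v b) := by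
  rw [ML.iff, hv.and, hv.imp, hv.imp]
  exact iff_iff_implies_and_implies.symm

theorem conj (l : List ML) : v (.conj l) ↔ ∀ a ∈ l, v a := by
  induction l with
  | nil => simpa [ML.conj] using hv.top
  | cons a l ih =>
    cases l with
    | nil => simp [ML.conj]
    | cons b l => simp only [ML.conj, hv.and, ih, List.forall_mem_cons]

end TruthAssignment

namespace IsNormalLogic

variable {L : Set ML} (hL : IsNormalLogic L)
include hL

theorem mem_of_entails {a b : ML} (ha : a ∈ L) (h : ∀ v, TruthAssignment v → v a → v b) :
    b ∈ L := by
  refine hL.mp a b (hL.taut _ fun v h1 h2 h3 h4 h5 => ?_) ha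
  have hv : TruthAssignment v := ⟨h1, h2, h3, h4, h5⟩
  exact (hv.imp a b).2 (h v hv)

theorem mem_of_entails₂ {a b c : ML} (ha : a ∈ L) (hb : b ∈ L)
    (h : ∀ v, TruthAssignment v → v a → v b → v c) : c ∈ L :=
  hL.mp b c (hL.mem_of_entails ha fun v hv hva => (hv.imp b c).2 (h v hv hva)) hb

theorem box_mono {a b : ML} (h : .imp a b ∈ L) : .imp (.box a) (.box b) ∈ L :=
  hL.mp _ _ (hL.axK a b) (hL.nec _ h)

/-- Boxes distribute over derivations from finitely many premises. -/
theorem box_conj {l : List ML} {a : ML} (h : .imp (.conj l) a ∈ L) :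
    .imp (.conj (l.map .box)) (.box a) ∈ L := by
  induction l generalizing a with
  | nil =>
    have ha : a ∈ L := hL.mem_of_entails h fun v hv h => (hv.imp _ _).1 h hv.top
    exact hL.mem_of_entails (hL.nec a ha) fun v hv h => (hv.imp _ _).2 fun _ => h
  | cons b l ih =>
    have h' : .imp (.conj l) (.imp b a) ∈ L := hL.mem_of_entails h fun v hv h => by
      simp only [hv.imp, hv.conj, List.forall_mem_cons] at h ⊢
      exact fun hl hb => h ⟨hb, hl⟩
    refine hL.mem_of_entails₂ (ih h') (hL.axK b a) fun v hv h hK => ?_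
    simp only [hv.imp, hv.conj, List.map_cons, List.forall_mem_cons] at h hK ⊢
    exact fun hl => hK (h hl.2) hl.1

end IsNormalLogic

/-- **Lindenbaum's lemma** -/
theorem Consistent.exists_canonicalWorld {L T : Set ML} (hT : Consistent L T) :
    ∃ Γ : CanonicalWorld L, T ⊆ Γ.1 := by
  have hfc : Order.IsOfFiniteCharacter {Γ | Consistent L Γ} := by
    intro Γ
    refine ⟨fun h Δ hΔ _ l hl => h l fun ψ hψ => hΔ (hl ψ hψ), fun h l hl => ?_⟩
    exact h {ψ | ψ ∈ l} hl l.finite_toSet l fun _ => id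
  obtain ⟨Γ, hTΓ, hΓ⟩ := hfc.exists_maximal hT
  exact ⟨⟨Γ, hΓ.prop, fun Δ hΔ hc => (hΓ.eq_of_subset hc hΔ).symm⟩, hTΓ⟩

namespace CanonicalWorld

variable {L : Set ML}

/-- A formula outside a maximal consistent set is refuted by finitely many of its members. -/
theorem exists_refutation (hL : IsNormalLogic L) (Γ : CanonicalWorld L) {ψ : ML} (hψ : ψ ∉ Γ.1) :
    ∃ l : List ML, (∀ χ ∈ l, χ ∈ Γ.1) ∧ .imp (.conj l) (.neg ψ) ∈ L := by
  classical
  have hinc : ¬ Consistent L (insert ψ Γ.1) := fun h =>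
    hψ (Γ.2.2 _ (Set.subset_insert ψ Γ.1) h ▸ Set.mem_insert ψ Γ.1)
  simp only [Consistent, not_forall, not_not] at hinc
  obtain ⟨l, hl, hlL⟩ := hinc
  refine ⟨l.filter (· ≠ ψ), fun χ hχ => ?_, hL.mem_of_entails hlL fun v hv h => ?_⟩
  · simp only [List.mem_filter, decide_eq_true_eq] at hχ
    exact (hl χ hχ.1).resolve_left hχ.2
  · simp only [hv.imp, hv.conj, hv.neg, List.mem_filter, decide_eq_true_eq] at h ⊢
    exact fun hl hψ => h fun χ hχ => by
      by_cases hχψ : χ = ψ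
      · exact hχψ ▸ hψ
      · exact hl χ ⟨hχ, hχψ⟩

theorem mem_of_derivable (hL : IsNormalLogic L) (Γ : CanonicalWorld L) {l : List ML} {ψ : ML}
    (hl : ∀ χ ∈ l, χ ∈ Γ.1) (h : .imp (.conj l) ψ ∈ L) : ψ ∈ Γ.1 := by
  by_contra hψ
  obtain ⟨l', hl', h'⟩ := exists_refutation hL Γ hψ
  refine Γ.2.1 (l ++ l') (fun χ hχ => (List.mem_append.1 hχ).elim (hl χ) (hl' χ)) ?_
  refine hL.mem_of_entails₂ h h' fun v hv h h' => ?_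
  simp only [hv.imp, hv.conj, hv.neg, List.forall_mem_append] at h h' ⊢
  exact fun hll => h' hll.2 (h hll.1)

theorem mem_of_entails (hL : IsNormalLogic L) (Γ : CanonicalWorld L) {l : List ML} {ψ : ML}
    (hl : ∀ χ ∈ l, χ ∈ Γ.1) (h : ∀ v, TruthAssignment v → (∀ χ ∈ l, v χ) → v ψ) : ψ ∈ Γ.1 := by
  refine mem_of_derivable hL Γ hl (hL.taut _ fun v h1 h2 h3 h4 h5 => ?_)
  have hv : TruthAssignment v := ⟨h1, h2, h3, h4, h5⟩
  exact (hv.imp _ _).2 fun h' => h v hv ((hv.conj l).1 h')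

theorem mem_of_mem_logic (hL : IsNormalLogic L) (Γ : CanonicalWorld L) {ψ : ML} (hψ : ψ ∈ L) :
    ψ ∈ Γ.1 :=
  mem_of_derivable hL Γ (l := []) (by simp)
    (hL.mem_of_entails hψ fun _ hv h => (hv.imp _ _).2 fun _ => h)

/-- Membership in a maximal consistent set respects the Boolean connectives. -/
theorem truthAssignment (hL : IsNormalLogic L) (Γ : CanonicalWorld L) :
    TruthAssignment (· ∈ Γ.1) := by
  have hbot : ML.bot ∉ Γ.1 := fun h => by
    refine Γ.2.1 [.bot] (by simpa using h) (hL.taut _ fun v h1 _ h3 _ _ => (h3 _).2 h1)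
  have hneg : ∀ a, ML.neg a ∈ Γ.1 ↔ a ∉ Γ.1 := by
    refine fun a => ⟨fun hn ha => hbot ?_, fun ha => ?_⟩
    · refine mem_of_entails hL Γ (l := [a, .neg a]) (by simp [hn, ha]) fun v hv h => ?_
      simp only [List.forall_mem_cons, hv.neg] at h
      exact (h.2.1 h.1).elim
    · obtain ⟨l, hl, hlL⟩ := exists_refutation hL Γ ha
      exact mem_of_derivable hL Γ hl hlL
  refine ⟨hbot, mem_of_entails hL Γ (l := []) (by simp) fun v hv _ => hv.top, hneg,
    fun a b => ⟨fun h => ?_, fun h => ?_⟩, fun a b => ⟨fun h => ⟨?_, ?_⟩, fun h => ?_⟩⟩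
  · by_contra! hab
    refine hbot (mem_of_entails hL Γ (l := [.or a b, .neg a, .neg b])
      (by simp [h, hneg, hab]) fun v hv h => ?_)
    simp only [List.forall_mem_cons, hv.neg, hv.or] at h
    tauto
  · rcases h with h | h
    · exact mem_of_entails hL Γ (l := [a]) (by simpa using h) fun v hv h =>
        (hv.or a b).2 (.inl (by simpa using h))
    · exact mem_of_entails hL Γ (l := [b]) (by simpa using h) fun v hv h =>
        (hv.or a b).2 (.inr (by simpa using h))
  · exact mem_of_entails hL Γ (l := [.and a b]) (by simpa using h) fun v hv h =>
      ((hv.and a b).1 (by simpa using h)).1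
  · exact mem_of_entails hL Γ (l := [.and a b]) (by simpa using h) fun v hv h =>
      ((hv.and a b).1 (by simpa using h)).2
  · exact mem_of_entails hL Γ (l := [a, b]) (by simpa using h) fun v hv h =>
      (hv.and a b).2 (by simpa using h)

/-- The existence lemma for diamonds. -/
theorem dia_mem_iff (hL : IsNormalLogic L) (Γ : CanonicalWorld L) (ψ : ML) :
    .dia ψ ∈ Γ.1 ↔ ∃ Δ, canonicalRel L Γ Δ ∧ ψ ∈ Δ.1 := by
  classical
  refine ⟨fun hψ => ?_, fun ⟨Δ, hR, hΔ⟩ => hR ψ hΔ⟩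
  have hTA := truthAssignment hL
  have hdual : ∀ χ, .dia χ ∈ Γ.1 ↔ .box (.neg χ) ∉ Γ.1 := fun χ => by
    rw [← (hTA Γ).neg, ← (hTA Γ).iff]
    exact mem_of_mem_logic hL Γ (hL.dual χ)
  have hcons : Consistent L (insert ψ {χ | .box χ ∈ Γ.1}) := by
    intro l hl hlL
    have hder : .imp (.conj (l.filter (· ≠ ψ))) (.neg ψ) ∈ L :=
      hL.mem_of_entails hlL fun v hv h => by
        simp only [hv.imp, hv.conj, hv.neg, List.mem_filter, decide_eq_true_eq] at h ⊢
        exact fun hl hψ => h fun χ hχ => by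
          by_cases hχψ : χ = ψ
          · exact hχψ ▸ hψ
          · exact hl χ ⟨hχ, hχψ⟩
    refine (hdual ψ).1 hψ (mem_of_derivable hL Γ (fun χ hχ => ?_) (hL.box_conj hder))
    obtain ⟨θ, hθ, rfl⟩ := List.mem_map.1 hχ
    simp only [List.mem_filter, decide_eq_true_eq] at hθ
    exact (hl θ hθ.1).resolve_left hθ.2
  obtain ⟨Δ, hΔ⟩ := hcons.exists_canonicalWorld
  refine ⟨Δ, fun χ hχ => ?_, hΔ (Set.mem_insert _ _)⟩
  rw [hdual]
  exact fun h => ((hTA Δ).neg χ).1 (hΔ (.inr h)) hχ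

theorem box_mem_iff (hL : IsNormalLogic L) (Γ : CanonicalWorld L) (ψ : ML) :
    .box ψ ∈ Γ.1 ↔ ∀ Δ, canonicalRel L Γ Δ → ψ ∈ Δ.1 := by
  have hTA := truthAssignment hL
  have hdual := mem_of_mem_logic hL Γ (hL.dual (.neg ψ))
  rw [(hTA Γ).iff, (hTA Γ).neg, dia_mem_iff hL] at hdual
  have hnn : .box ψ ∈ Γ.1 ↔ .box (.neg (.neg ψ)) ∈ Γ.1 := by
    have h1 : .imp ψ (.neg (.neg ψ)) ∈ L := hL.mem_of_entails (hL.taut .top fun _ _ h _ _ _ => h)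
      fun v hv _ => by simp [hv.imp, hv.neg]
    have h2 : .imp (.neg (.neg ψ)) ψ ∈ L := hL.mem_of_entails (hL.taut .top fun _ _ h _ _ _ => h)
      fun v hv _ => by simp [hv.imp, hv.neg]
    exact ⟨((hTA Γ).imp _ _).1 (mem_of_mem_logic hL Γ (hL.box_mono h1)),
      ((hTA Γ).imp _ _).1 (mem_of_mem_logic hL Γ (hL.box_mono h2))⟩
  rw [hnn, ← not_iff_not, ← hdual]
  push Not
  exact exists_congr fun Δ => and_congr_right fun _ => (hTA Δ).neg ψ

end CanonicalWorld

/-! ### The canonical general frame -/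

/-- The canonical general frame of `L`: the canonical frame with the sets `{Γ | ψ ∈ Γ}` of worlds as
admissible sets. -/
def canonicalGeneralFrame {L : Set ML} (hL : IsNormalLogic L) :
    GeneralFrame (CanonicalWorld L) where
  R := canonicalRel L
  Adm := Set.range fun ψ => {Γ | ψ ∈ Γ.1}
  empty_mem := ⟨.bot, Set.eq_empty_of_forall_notMem fun Γ => (Γ.truthAssignment hL).bot⟩
  compl_mem := by
    rintro _ ⟨ψ, rfl⟩
    exact ⟨.neg ψ, Set.ext fun Γ => (Γ.truthAssignment hL).neg ψ⟩
  union_mem := by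
    rintro _ ⟨ψ, rfl⟩ _ ⟨χ, rfl⟩
    exact ⟨.or ψ χ, Set.ext fun Γ => (Γ.truthAssignment hL).or ψ χ⟩
  dia_mem := by
    rintro _ ⟨ψ, rfl⟩
    exact ⟨.dia ψ, Set.ext fun Γ => Γ.dia_mem_iff hL ψ⟩

theorem canonicalGeneralFrame_descriptive {L : Set ML} (hL : IsNormalLogic L) :
    (canonicalGeneralFrame hL).Descriptive := by
  refine ⟨fun Γ Δ hne => ?_, fun Γ Δ => ⟨?_, fun h ψ hψ => ?_⟩, fun C hC hfip => ?_⟩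
  · have : ¬ Γ.1 ⊆ Δ.1 := fun h => hne (Subtype.ext (Γ.2.2 _ h Δ.2.1).symm)
    obtain ⟨ψ, hΓ, hΔ⟩ := Set.not_subset.1 this
    exact ⟨_, ⟨ψ, rfl⟩, hΓ, hΔ⟩
  · exact fun hR Y _ hΔ => ⟨Δ, hR, hΔ⟩
  · exact (Γ.dia_mem_iff hL ψ).2 (h _ ⟨ψ, rfl⟩ hψ)
  · have hcons : Consistent L {ψ | {Γ : CanonicalWorld L | ψ ∈ Γ.1} ∈ C} := by
      intro l hl hlL
      obtain ⟨Γ, hΓ⟩ := hfip ((fun ψ => {Γ : CanonicalWorld L | ψ ∈ Γ.1}) '' {ψ | ψ ∈ l})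
        (by rintro _ ⟨ψ, hψ, rfl⟩; exact hl ψ hψ) (l.finite_toSet.image _)
      exact Γ.2.1 l (fun ψ hψ => hΓ _ ⟨ψ, hψ, rfl⟩) hlL
    obtain ⟨Γ, hΓ⟩ := hcons.exists_canonicalWorld
    refine ⟨Γ, fun X hX => ?_⟩
    obtain ⟨ψ, rfl⟩ := hC hX
    exact hΓ hX

/-- The truth lemma, for the admissible valuation given by a substitution. -/
theorem sat_canonical_iff {L : Set ML} (hL : IsNormalLogic L) (σ : ℕ → ML) (φ : ML)
    (Γ : CanonicalWorld L) :
    φ.Sat (canonicalRel L) (fun k => {Γ | σ k ∈ Γ.1}) Γ ↔ φ.subst σ ∈ Γ.1 := by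
  induction φ generalizing Γ with
  | bot => exact iff_of_false id (Γ.truthAssignment hL).bot
  | top => exact iff_of_true trivial (Γ.truthAssignment hL).top
  | var k => rfl
  | neg φ ih => exact (not_congr (ih Γ)).trans ((Γ.truthAssignment hL).neg _).symm
  | or φ ψ ih ih' => exact (or_congr (ih Γ) (ih' Γ)).trans ((Γ.truthAssignment hL).or _ _).symm
  | and φ ψ ih ih' => exact (and_congr (ih Γ) (ih' Γ)).trans ((Γ.truthAssignment hL).and _ _).symm
  | dia φ ih => simp only [ML.Sat, ih, ML.subst, Γ.dia_mem_iff hL]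
  | box φ ih => simp only [ML.Sat, ih, ML.subst, Γ.box_mem_iff hL]

theorem LocallyDPersistent.canonical {φ : ML} (h : LocallyDPersistent.{0} φ) : Canonical φ := by
  intro L hL hφ Γ
  refine (h _ (canonicalGeneralFrame hL) (canonicalGeneralFrame_descriptive hL) Γ).1 ?_
  intro V hV
  choose σ hσ using hV
  obtain rfl : (fun k => {Γ : CanonicalWorld L | σ k ∈ Γ.1}) = V := funext hσ
  exact (sat_canonical_iff hL σ φ Γ).2 (Γ.mem_of_mem_logic hL (hL.subst σ φ hφ))

end Sqema

theorem mainTheorem1 (φ : Sqema.ML) (hφ : Sqema.Succeeds φ) :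
    Sqema.LocallyDPersistent.{u} φ ∧ Sqema.Canonical φ ∧
      ∀ χ : Sqema.L0.Formula Unit, Sqema.Returns φ χ → Sqema.LocalCorrespondent.{u} χ φ := by
  exact ⟨hφ.locallyDPersistent, hφ.locallyDPersistent.canonical, fun χ h => h.localCorrespondent⟩
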